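/- All graphs are finite and simple. In an on-line coloring, the vertices of a graph $G$ are presented one by one in an order $\pi=(v_1,\dots,v_n)$, and a (deterministic) on-line algorithm $A$ irrevocably colors $v_i$ when it is presented; the color of $v_i$ depends only on the graph induced by $v_1,\dots,v_i$, with its vertices known only by their positions in the order. $A$ colors $G$ properly if the coloring is proper for every order $\pi$. Let $A(G,\pi)$ be the number of colors used, and let $\chi_*(G)=\inf_A\max_\pi A(G,\pi)$ be the on-line chromatic number of $G$, where $A$ ranges over the on-line algorithms that color $G$ properly. A graph is $P_9$-free if it has no induced path on $9$ vertices. Consider the following on-line algorithm $\mathcal A$ for bipartite graphs, whose colors come from three disjoint palettes $a_1,a_2,\dots$; $b_1,b_2,\dots$; $c_1,c_2,\dots$. For a presented vertex $v$ and $i\ge 0$, let $C_i[v]$ be the connected component containing $v$ of the graph induced by $v$ and those vertices presented before $v$ whose color is one of $a_1,\dots,a_i,b_1,\dots,b_i,c_1,\dots,c_i$ (so $C_0[v]=\{v\}$). The two sides of $C_i[v]$ are the two classes of its bipartition (one is empty if $C_i[v]=\{v\}$). The color $a_i$ is mixed in $C_i[v]$ if it occurs on both sides. A vertex is universal to $C_i[v]$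 if it is adjacent to all vertices of one of the sides of $C_i[v]$. A vertex has color index $j$ if its color is $a_j$ or $b_j$. When a new vertex $v$ is presented, let $m=\max\{i\ge 1: a_i\text{ is mixed in }C_i[v]\}+1$ (with $\max\emptyset=0$) and let $I_1\ni v$ and $I_2$ be the sides of $C_m[v]$. Then 1. if $a_m$ occurs on $I_2$, color $v$ with $b_m$; 2. otherwise, if $c_m$ occurs on $I_2$, color $v$ with $a_m$; 3. otherwise, if there are $u\in I_1\cup I_2$ and $u'\in I_2$ such that $u$ has color index $j\ge m-\sqrt{2m}+2$ and $u'$ is universal to $C_{j-1}[u]$, color $v$ with $c_m$; 4. otherwise, color $v$ with $a_m$. **Theorem.** For every $P_9$-free bipartite graph $G$ and every presentation order $\pi$ of its vertices, $\mathcal A$ colors $G$ properly and uses at most $6(\chi_*(G)+1)^2$ colors. In particular $\mathcal A$ is on-line competitive on the class of $P_9$-free bipartite graphs: it colors these graphs properly and there is a function $f$ such that $\mathcal A(G,\pi)\le f(\chi_*(G))$ for every such $G$ and $\pi$. -/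

import Mathlib

universe u

namespace OnlineColoring

/-! ### On-line colorings -/

/-- A deterministic on-line algorithm with color set `C`. When the `(n+1)`-st vertex is presented, the
algorithm sees the graph induced by the vertices presented so far, in which the vertices are known only by
their position `0, …, n` in the presentation order, and it returns the color of the newest vertex, number `n`.
It knows neither the rest of the graph nor the total number of vertices. -/
def OnlineAlgorithm (C : Type) : Type :=
  (n : ℕ) → SimpleGraph (Fin (n + 1)) → C

/-- The graph seen when the vertex in position `i` of the order `π` is presented. -/
def presented {V : Type u} {n : ℕ} (G : SimpleGraph V) (π : Fin n ≃ V) (i : Fin n) :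
    SimpleGraph (Fin (i.val + 1)) :=
  G.comap (fun j => π (Fin.castLE i.isLt j))

/-- The coloring that `A` produces on the on-line graph `(G, π)`; the order `π` presents
`π 0, π 1, …, π (n-1)`. -/
def OnlineAlgorithm.coloring {C : Type} (A : OnlineAlgorithm C) {V : Type u} {n : ℕ}
    (G : SimpleGraph V) (π : Fin n ≃ V) : V → C :=
  fun v => A (π.symm v).val (presented G π (π.symm v))

/-- The number `A(G, π)` of colors that `A` uses on `(G, π)`. -/
noncomputable def OnlineAlgorithm.numColors {C : Type} (A : OnlineAlgorithm C) {V : Type u} {n : ℕ}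
    (G : SimpleGraph V) (π : Fin n ≃ V) : ℕ :=
  (Set.range (A.coloring G π)).ncard

/-- `A` colors `G` properly for every presentation order. -/
def OnlineAlgorithm.ColorsProperly {C : Type} (A : OnlineAlgorithm C) {V : Type u}
    (G : SimpleGraph V) : Prop :=
  ∀ (n : ℕ) (π : Fin n ≃ V) (v w : V), G.Adj v w → A.coloring G π v ≠ A.coloring G π w

/-- The on-line chromatic number `inf_A max_π A(G, π)` of a finite graph `G`. The infimum is over all on-line
algorithms that color `G` properly, including those designed for `G` only. Countably many colors suffice,
because there are only countably many possible inputs. -/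
noncomputable def onlineChromaticNumber {V : Type u} (G : SimpleGraph V) : ℕ :=
  sInf {k : ℕ | ∃ A : OnlineAlgorithm ℕ, A.ColorsProperly G ∧
    ∀ (n : ℕ) (π : Fin n ≃ V), A.numColors G π ≤ k}

/-- `A` is on-line competitive on the class `𝒢` of finite graphs. -/
def OnlineAlgorithm.IsOnlineCompetitive {C : Type} (A : OnlineAlgorithm C)
    (𝒢 : ∀ V : Type u, SimpleGraph V → Prop) : Prop :=
  ∃ f : ℕ → ℕ, ∀ (V : Type u) [Finite V] (G : SimpleGraph V), 𝒢 V G →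
    A.ColorsProperly G ∧
      ∀ (n : ℕ) (π : Fin n ≃ V), A.numColors G π ≤ f (onlineChromaticNumber G)

/-- Bipartite graphs with no induced path on `9` vertices. -/
def P9FreeBipartite (V : Type u) (G : SimpleGraph V) : Prop :=
  G.IsBipartite ∧ ¬ (SimpleGraph.pathGraph 9).IsIndContained G

/-! ### The algorithm -/

/-- The three disjoint palettes `a₁, a₂, …`, `b₁, b₂, …` and `c₁, c₂, …`. -/
inductive Color : Type
  | a (i : ℕ)
  | b (i : ℕ)
  | c (i : ℕ)

/-- The subscript of a color. -/
def Color.subscript : Color → ℕ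
  | .a i => i
  | .b i => i
  | .c i => i

section Components

/- Below, the vertices `0, …, N-1` of `H` are numbered in the order of presentation and `col` gives the colors
of the vertices that are colored already. -/
variable {N : ℕ} (H : SimpleGraph (Fin N)) (col : Fin N → Option Color)

/-- The color index of `v` is `j`: the color of `v` is `a_j` or `b_j` (not `c_j`). -/
def HasColorIndex (v : Fin N) (j : ℕ) : Prop :=
  col v = some (.a j) ∨ col v = some (.b j)

/-- The vertices of `G_i[v]`: the vertex `v`, and the vertices presented before `v` whose color is one of
`a_1, …, a_i, b_1, …, b_i, c_1, …, c_i`. -/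
def levelSet (i : ℕ) (v : Fin N) : Set (Fin N) :=
  {w | w = v ∨ (w < v ∧ ∃ x, col w = some x ∧ x.subscript ≤ i)}

/-- The graph `G_i[v]`; vertices outside `levelSet` are kept as isolated vertices. -/
def levelGraph (i : ℕ) (v : Fin N) : SimpleGraph (Fin N) :=
  (H.induce (levelSet col i v)).spanningCoe

/-- The vertex set of the connected component `C_i[v]` of `v` in `G_i[v]`. -/
def component (i : ℕ) (v : Fin N) : Set (Fin N) :=
  {w | (levelGraph H col i v).Reachable v w}

/-- The side of `C_i[v]` that contains `v`. -/
def ownSide (i : ℕ) (v : Fin N) : Set (Fin N) :=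
  {w | ∃ p : (levelGraph H col i v).Walk v w, Even p.length}

/-- The side of `C_i[v]` that does not contain `v`. -/
def otherSide (i : ℕ) (v : Fin N) : Set (Fin N) :=
  {w | ∃ p : (levelGraph H col i v).Walk v w, Odd p.length}

/-- The color `a_i` is mixed in `C_i[v]`: it is used on both sides. -/
def IsMixed (i : ℕ) (v : Fin N) : Prop :=
  (∃ x ∈ ownSide H col i v, col x = some (.a i)) ∧
    ∃ y ∈ otherSide H col i v, col y = some (.a i)

/-- `x` is universal to `C_i[u]`: it is adjacent to all vertices of one of the two sides of `C_i[u]`. -/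
def IsUniversalTo (x : Fin N) (i : ℕ) (u : Fin N) : Prop :=
  (∀ w ∈ ownSide H col i u, H.Adj x w) ∨ ∀ w ∈ otherSide H col i u, H.Adj x w

/-- The number `m = max {i ≥ 1 | a_i is mixed in C_i[v]} + 1`, where `max ∅ = 0`. -/
noncomputable def nextIndex (v : Fin N) : ℕ :=
  sSup {i : ℕ | 1 ≤ i ∧ IsMixed H col i v} + 1

open Classical in
/-- The color given to the newly presented, still uncolored vertex `v`. -/
noncomputable def chooseColor (v : Fin N) : Color :=
  let m := nextIndex H col v
  if ∃ w ∈ otherSide H col m v, col w = some (.a m) then .b m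
  else if ∃ w ∈ otherSide H col m v, col w = some (.c m) then .a m
  else if ∃ u ∈ component H col m v, ∃ u' ∈ otherSide H col m v, ∃ j : ℕ,
      HasColorIndex col u j ∧ (m : ℝ) - Real.sqrt (2 * (m : ℝ)) + 2 ≤ (j : ℝ) ∧
        IsUniversalTo H col u' (j - 1) u then .c m
  else .a m

end Components

/-- The on-line algorithm: the earlier vertices have the colors that the algorithm gave to them when they were
presented, the newest vertex `n` is still uncolored, and `chooseColor` picks its color. -/
noncomputable def algorithm1 : OnlineAlgorithm Color
  | n, H =>
    chooseColor H
      (fun w => if h : w.val < n then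
          some (algorithm1 w.val (H.comap (Fin.castLE (Nat.succ_le_succ h.le))))
        else none)
      (Fin.last n)
termination_by n => n

end OnlineColoring

/-!
The algorithm is compared with an adversary by means of *layered structures* (`Layered`). Such a
structure of depth `k + 1` consists of two separated structures of depth `k`, of opposite
orientation, and a root that is complete to the opposite side of at least one of them.

*Layered structures force colors* (`lt_onlineChromaticNumber`). Suppose that in every structure of
depth `k` the adversary can force `t` colors on the root side, with a strategy that does not depend
on the structure. It plays this strategy twice. If the two color sets differ, it places both copies
in a structure of depth `k + 2` with the same orientation, so that they show `t + 1` colors on the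
root side. If they agree, it places them with opposite orientations in the half that the root
dominates, and presents the root: the root sees the color set of the second copy, hence has a new
color, and it is on the same side as the color set of the first copy. So depth `2 * t` forces
`t + 1` colors.

*Large subscripts give deep structures* (`IsGreedy.layered_of_eq_a`, `IsGreedy.exists_layered`). A
vertex of subscript `m + 1` merges two components that contain vertices `x` and `y` of color `a_m`,
one on each side (`IsGreedy.exists_merge`). If a vertex is universal to such a merged component, it
is the root of a structure one layer deeper than those at `x` and `y`; the palette `c` guarantees
that it is on the right side, and the window in the third rule that the square root of `2 * m` drops
by at most one (`sq_le_of_window`). If nothing is universal to the components of vertices with color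
index in the window, the merging vertices are themselves the roots. A merging vertex `v` cannot be
continued to an induced path on five vertices in both components, since the graph has no induced
path on nine vertices. In a component in which it cannot, `v` is adjacent to all merging vertices of
the window on the opposite side (`NoLongPath.adj`). Either way a subscript `m` with
`(k + 2) ^ 2 ≤ 2 * m` gives a structure of depth `k`.

With `k` twice the on-line chromatic number the two parts contradict each other, so that all
subscripts are at most `2 * (onlineChromaticNumber G + 1) ^ 2`, and there are three palettes.
-/

namespace OnlineColoring

/-! ### Layered structures -/

section Layered

variable {V : Type u} (G : SimpleGraph V)

/-- The vertex sets `S` and `T` are disjoint and no edge of `G` joins them. -/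
def Separated (S T : Set V) : Prop :=
  ∀ s ∈ S, ∀ t ∈ T, s ≠ t ∧ ¬ G.Adj s t

variable {G} in
theorem Separated.symm {S T : Set V} (h : Separated G S T) : Separated G T S :=
  fun t ht s hs => ⟨(h s hs t ht).1.symm, fun e => (h s hs t ht).2 e.symm⟩

variable {G} in
theorem Separated.mono {S T S' T' : Set V} (h : Separated G S T) (hS : S' ⊆ S) (hT : T' ⊆ T) :
    Separated G S' T' :=
  fun s hs t ht => h s (hS hs) t (hT ht)

/-- A layered structure of depth `k` with root side `b` in the vertex set `U`, relative to the
bipartition `c`. It has a root `r ∈ U` on side `b`. A structure of depth `k + 1` contains two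
separated structures of depth `k`, one with root side `b` and one with root side `!b`, and `r` is
complete to the opposite side of at least one of them; nothing is asked of the adjacency of `r` to
the other one. -/
def Layered (c : V → Bool) : ℕ → Bool → Set V → Prop
  | 0, b, U => ∃ v ∈ U, c v = b
  | k + 1, b, U => ∃ U₁ U₂ : Set V, U₁ ⊆ U ∧ U₂ ⊆ U ∧ Separated G U₁ U₂ ∧
      Layered c k b U₁ ∧ Layered c k (!b) U₂ ∧ ∃ r ∈ U, c r = b ∧
        ((r ∉ U₁ ∧ ∀ w ∈ U₁, c w = !b → G.Adj r w) ∨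
          (r ∉ U₂ ∧ ∀ w ∈ U₂, c w = !b → G.Adj r w))

variable {G} {c : V → Bool}

theorem Layered.mono {k : ℕ} {b : Bool} {U U' : Set V} (h : Layered G c k b U) (hU : U ⊆ U') :
    Layered G c k b U' := by
  cases k with
  | zero =>
    obtain ⟨v, hv, hc⟩ := h
    exact ⟨v, hU hv, hc⟩
  | succ k =>
    obtain ⟨U₁, U₂, h1, h2, hs, hg1, hg2, r, hr, hcr, hor⟩ := h
    exact ⟨U₁, U₂, h1.trans hU, h2.trans hU, hs, hg1, hg2, r, hU hr, hcr, hor⟩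

/-- Two separated structures of the same orientation are found two layers down, one in each half. -/
theorem Layered.exists_parallel {k : ℕ} {b : Bool} {U : Set V} (h : Layered G c (k + 2) b U) :
    ∃ P Q : Set V, P ⊆ U ∧ Q ⊆ U ∧ Separated G P Q ∧ Layered G c k b P ∧ Layered G c k b Q := by
  obtain ⟨U₁, U₂, h1, h2, hs, ⟨A, B, hA, hB, -, gA, gB, -⟩, ⟨C, D, hC, hD, -, gC, gD, -⟩, -⟩ := h
  rw [Bool.not_not] at gD
  exact ⟨A, D, hA.trans h1, hD.trans h2, hs.mono hA hD, gA, gD⟩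

/-- Two layers down, inside the half that the root dominates, there are two separated structures of
opposite orientation that are both dominated by the root. -/
theorem Layered.exists_dominated {k : ℕ} {b : Bool} {U : Set V} (h : Layered G c (k + 2) b U) :
    ∃ P Q : Set V, P ⊆ U ∧ Q ⊆ U ∧ Separated G P Q ∧ Layered G c k b P ∧ Layered G c k (!b) Q ∧
      ∃ r ∈ U, c r = b ∧ r ∉ P ∧ r ∉ Q ∧ (∀ w ∈ P, c w = !b → G.Adj r w) ∧
        ∀ w ∈ Q, c w = !b → G.Adj r w := by
  obtain ⟨U₁, U₂, h1, h2, -, ⟨A, B, hA, hB, sAB, gA, gB, -⟩, ⟨C, D, hC, hD, sCD, gC, gD, -⟩,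
    r, hr, hcr, ⟨hr1, hadj⟩ | ⟨hr2, hadj⟩⟩ := h
  · exact ⟨A, B, hA.trans h1, hB.trans h1, sAB, gA, gB, r, hr, hcr, fun h => hr1 (hA h),
      fun h => hr1 (hB h), fun w hw => hadj w (hA hw), fun w hw => hadj w (hB hw)⟩
  · rw [Bool.not_not] at gD
    exact ⟨D, C, hD.trans h2, hC.trans h2, sCD.symm, gD, gC, r, hr, hcr, fun h => hr2 (hD h),
      fun h => hr2 (hC h), fun w hw => hadj w (hD hw), fun w hw => hadj w (hC hw)⟩

theorem Layered.map {W : Type*} (f : W ↪ V) {k : ℕ} {b : Bool} {U : Set W}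
    (h : Layered (G.comap f) (c ∘ f) k b U) : Layered G c k b (f '' U) := by
  induction k generalizing b U with
  | zero =>
    obtain ⟨v, hv, hc⟩ := h
    exact ⟨f v, ⟨v, hv, rfl⟩, hc⟩
  | succ k ih =>
    obtain ⟨U₁, U₂, h1, h2, hs, hg1, hg2, r, hr, hcr, hor⟩ := h
    refine ⟨f '' U₁, f '' U₂, Set.image_mono h1, Set.image_mono h2, ?_, ih hg1, ih hg2,
      f r, ⟨r, hr, rfl⟩, hcr, ?_⟩
    · rintro _ ⟨s, hs', rfl⟩ _ ⟨t, ht, rfl⟩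
      exact ⟨fun e => (hs s hs' t ht).1 (f.injective e), (hs s hs' t ht).2⟩
    · refine hor.imp ?_ ?_ <;>
      · rintro ⟨h, h'⟩
        refine ⟨fun hm => h ((f.injective.mem_set_image).1 hm), ?_⟩
        rintro _ ⟨w, hw, rfl⟩ hc
        exact h' w hw hc

end Layered

/-! ### The adversary -/

section Adversary

/-- The color that `A` gives to the vertex in position `i` of the on-line graph `H`, whose vertices
are presented in the order `0, 1, …`. -/
def positionColor (A : OnlineAlgorithm ℕ) (H : SimpleGraph ℕ) (i : ℕ) : ℕ :=
  A i (H.comap (fun j : Fin (i + 1) => (j : ℕ)))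

theorem positionColor_congr (A : OnlineAlgorithm ℕ) {H H' : SimpleGraph ℕ} {n i : ℕ} (hi : i < n)
    (h : ∀ i j, i < n → j < n → (H'.Adj i j ↔ H.Adj i j)) :
    positionColor A H' i = positionColor A H i := by
  have : H'.comap (fun j : Fin (i + 1) => (j : ℕ)) = H.comap (fun j : Fin (i + 1) => (j : ℕ)) := by
    ext a b
    exact h a b (by have := a.2; omega) (by have := b.2; omega)
  simp only [positionColor, this]

variable {V : Type u} {G : SimpleGraph V}

/-- `g` embeds the graph induced by the positions `m, …, n - 1` of `H` into `G` as an induced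
subgraph. -/
def PartialCopy (G : SimpleGraph V) (H : SimpleGraph ℕ) (m n : ℕ) (g : ℕ → V) : Prop :=
  ∀ i j, m ≤ i → i < n → m ≤ j → j < n → (g i = g j → i = j) ∧ (G.Adj (g i) (g j) ↔ H.Adj i j)

theorem PartialCopy.congr {H H' : SimpleGraph ℕ} {m n k : ℕ} {g : ℕ → V}
    (h : PartialCopy G H m n g) (hn : n ≤ k)
    (hH : ∀ i j, i < k → j < k → (H'.Adj i j ↔ H.Adj i j)) : PartialCopy G H' m n g :=
  fun i j h1 h2 h3 h4 => ⟨(h i j h1 h2 h3 h4).1,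
    (h i j h1 h2 h3 h4).2.trans (hH i j (by omega) (by omega)).symm⟩

theorem PartialCopy.glue {H : SimpleGraph ℕ} {m k n : ℕ} {g₁ g₂ : ℕ → V}
    (h₁ : PartialCopy G H m k g₁) (h₂ : PartialCopy G H k n g₂)
    (hc : ∀ i j, m ≤ i → i < k → k ≤ j → j < n →
      g₁ i ≠ g₂ j ∧ (G.Adj (g₁ i) (g₂ j) ↔ H.Adj i j)) :
    PartialCopy G H m n (fun i => if i < k then g₁ i else g₂ i) := by
  intro i j hi hi' hj hj'
  by_cases hik : i < k <;> by_cases hjk : j < k <;> simp only [hik, hjk, if_true, if_false]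
  · exact h₁ i j hi hik hj hjk
  · have := hc i j hi hik (by omega) hj'
    exact ⟨fun e => absurd e this.1, this.2⟩
  · have := hc j i hj hjk (by omega) hi'
    refine ⟨fun e => absurd e.symm this.1, ?_⟩
    rw [G.adj_comm, H.adj_comm]
    exact this.2
  · exact h₂ i j (by omega) hi' (by omega) hj'

theorem PartialCopy.exists_order [Finite V] {H : SimpleGraph ℕ} {n : ℕ} {f : ℕ → V}
    (h : PartialCopy G H 0 n f) :
    ∃ (N : ℕ) (π : Fin N ≃ V), ∀ (A : OnlineAlgorithm ℕ) (i : ℕ), i < n →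
      A.coloring G π (f i) = positionColor A H i := by
  classical
  obtain ⟨N, ⟨σ⟩⟩ := Finite.exists_equiv_fin V
  have hinj : Function.Injective (fun i : Fin n => f i) := fun i j e =>
    Fin.ext ((h i j (Nat.zero_le _) i.2 (Nat.zero_le _) j.2).1 e)
  have hnN : n ≤ N := by
    simpa using Fintype.card_le_of_injective _ (σ.injective.comp hinj)
  obtain ⟨τ, hτ⟩ := Equiv.Perm.exists_extending_pair (fun i : Fin n => σ.symm (Fin.castLE hnN i))
    (fun i : Fin n => f i) (σ.symm.injective.comp (Fin.castLE_injective hnN)) hinj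
  refine ⟨N, σ.symm.trans τ, fun A i hi => ?_⟩
  have hπ : ∀ (j : Fin n), (σ.symm.trans τ) (Fin.castLE hnN j) = f j := fun j => hτ j
  have hs : (σ.symm.trans τ).symm (f i) = Fin.castLE hnN ⟨i, hi⟩ := by
    rw [Equiv.symm_apply_eq, hπ]
  have key : ∀ p : Fin N, p = Fin.castLE hnN ⟨i, hi⟩ →
      A p.val (presented G (σ.symm.trans τ) p) = positionColor A H i := by
    rintro _ rfl
    have : presented G (σ.symm.trans τ) (Fin.castLE hnN ⟨i, hi⟩) =
        H.comap (fun j : Fin (i + 1) => (j : ℕ)) := by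
      ext a b
      have ha : (a : ℕ) < n := by have := a.2; simp at this; omega
      have hb : (b : ℕ) < n := by have := b.2; simp at this; omega
      have e1 := hπ ⟨a, ha⟩
      have e2 := hπ ⟨b, hb⟩
      have := (h a b (Nat.zero_le _) ha (Nat.zero_le _) hb).2
      rw [← e1, ← e2] at this
      exact this
    simp only [positionColor, ← this]
    rfl
  exact key _ hs

theorem PartialCopy.positionColor_ne [Finite V] {A : OnlineAlgorithm ℕ} (hA : A.ColorsProperly G)
    {H : SimpleGraph ℕ} {n : ℕ} {f : ℕ → V} (h : PartialCopy G H 0 n f) {i j : ℕ} (hi : i < n)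
    (hj : j < n) (hij : H.Adj i j) : positionColor A H i ≠ positionColor A H j := by
  obtain ⟨N, π, hπ⟩ := h.exists_order
  rw [← hπ A i hi, ← hπ A j hj]
  exact hA N π _ _ ((h i j (Nat.zero_le _) hi (Nat.zero_le _) hj).2.2 hij)

/-- After the positions `0, …, n - 1` of `H` have been presented, the adversary can present further
positions, none of them adjacent to the old ones, such that `A` uses `t` colors on those of the new
positions that carry the label `σ`. The new positions can be placed in *every* layered structure of
depth `k`, with the positions labelled `σ` on the root side: the adversary has not committed itself
to a place in `G` or to an orientation. -/
def Forces (A : OnlineAlgorithm ℕ) (G : SimpleGraph V) (c : V → Bool) (k t : ℕ) (H : SimpleGraph ℕ)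
    (n : ℕ) : Prop :=
  ∃ (H' : SimpleGraph ℕ) (n' : ℕ) (σ : ℕ → Prop) (S : Finset ℕ), n ≤ n' ∧
    (∀ i j, i < n → j < n → (H'.Adj i j ↔ H.Adj i j)) ∧
    (∀ i j, i < n → n ≤ j → j < n' → ¬ H'.Adj i j) ∧
    S.card = t ∧
    (∀ s ∈ S, ∃ i, n ≤ i ∧ i < n' ∧ σ i ∧ positionColor A H' i = s) ∧
    ∀ (b : Bool) (U : Set V), Layered G c k b U → ∃ g : ℕ → V, PartialCopy G H' n n' g ∧
      ∀ i, n ≤ i → i < n' → g i ∈ U ∧ (σ i ↔ c (g i) = b)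

/-- The graph `H` on the positions below `n`, and a new position `n` adjacent to those of them that
satisfy `τ`. -/
def addVertex (H : SimpleGraph ℕ) (n : ℕ) (τ : ℕ → Prop) : SimpleGraph ℕ where
  Adj i j := (i < n ∧ j < n ∧ H.Adj i j) ∨ (i < n ∧ j = n ∧ τ i) ∨ (j < n ∧ i = n ∧ τ j)
  symm := ⟨by
    rintro i j (⟨h1, h2, h3⟩ | h | h)
    · exact Or.inl ⟨h2, h1, h3.symm⟩
    · exact Or.inr (Or.inr h)
    · exact Or.inr (Or.inl h)⟩
  loopless := ⟨by
    rintro i (⟨-, -, h⟩ | ⟨h1, h2, -⟩ | ⟨h1, h2, -⟩)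
    · exact H.irrefl h
    · omega
    · omega⟩

theorem addVertex_adj_old {H : SimpleGraph ℕ} {n : ℕ} {τ : ℕ → Prop} (i j : ℕ) (hi : i < n)
    (hj : j < n) : (addVertex H n τ).Adj i j ↔ H.Adj i j := by
  simp only [addVertex]
  constructor
  · rintro (h | h | h)
    · exact h.2.2
    · omega
    · omega
  · exact fun h => Or.inl ⟨hi, hj, h⟩

theorem addVertex_adj_new {H : SimpleGraph ℕ} {n : ℕ} {τ : ℕ → Prop} {i : ℕ} (hi : i < n) :
    (addVertex H n τ).Adj i n ↔ τ i := by
  simp only [addVertex]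
  constructor
  · rintro (h | h | h)
    · omega
    · exact h.2.2
    · omega
  · exact fun h => Or.inr (Or.inl ⟨hi, trivial, h⟩)

/-- A placement of the old positions and a placement of the new ones, separated from each other,
combine to one of all positions. -/
theorem PartialCopy.glue_separated {H : SimpleGraph ℕ} {m k n : ℕ} {g₁ g₂ : ℕ → V} {S T : Set V}
    (h₁ : PartialCopy G H m k g₁) (h₂ : PartialCopy G H k n g₂)
    (hS : ∀ i, m ≤ i → i < k → g₁ i ∈ S) (hT : ∀ i, k ≤ i → i < n → g₂ i ∈ T)
    (hsep : Separated G S T) (hH : ∀ i j, i < k → k ≤ j → j < n → ¬ H.Adj i j) :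
    PartialCopy G H m n (fun i => if i < k then g₁ i else g₂ i) := by
  refine h₁.glue h₂ fun i j hi hi' hj hj' => ?_
  have := hsep _ (hS i hi hi') _ (hT j hj hj')
  exact ⟨this.1, iff_of_false this.2 (hH i j hi' hj hj')⟩

theorem forces_zero (A : OnlineAlgorithm ℕ) (c : V → Bool) (H : SimpleGraph ℕ) (n : ℕ) :
    Forces A G c 0 1 H n := by
  refine ⟨addVertex H n (fun _ => False), n + 1, fun _ => True,
    {positionColor A (addVertex H n (fun _ => False)) n}, Nat.le_succ n,
    fun i j hi hj => addVertex_adj_old i j hi hj, ?_, Finset.card_singleton _, ?_, ?_⟩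
  · intro i j hi hj hj'
    obtain rfl : j = n := by omega
    rw [addVertex_adj_new hi]
    exact not_false
  · intro s hs
    exact ⟨n, le_rfl, Nat.lt_succ_self n, trivial, (Finset.mem_singleton.1 hs).symm⟩
  · rintro b U ⟨v, hv, hc⟩
    refine ⟨fun _ => v, fun i j h1 h2 h3 h4 => ?_, fun i _ _ => ⟨hv, iff_of_true trivial hc⟩⟩
    obtain rfl : i = j := by omega
    exact ⟨fun _ => rfl, iff_of_false G.irrefl (SimpleGraph.irrefl _)⟩

/-- Two more layers force one more color. The adversary plays the strategy for depth `k` twice. If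
the two color sets differ, both copies are placed with the same orientation. If they agree, they are
placed with opposite orientations under a common root, which sees the color set of the second one
and therefore receives a new color; it lies on the same side as the color set of the first one. -/
theorem forces_add_two [Finite V] {A : OnlineAlgorithm ℕ} (hA : A.ColorsProperly G)
    (c : G.Coloring Bool) {k t : ℕ}
    (ih : ∀ (H : SimpleGraph ℕ) (n : ℕ) (f : ℕ → V) (b : Bool) (U : Set V), PartialCopy G H 0 n f →
      Layered G c k b U → Separated G (f '' Set.Iio n) U → Forces A G c k t H n)
    (H : SimpleGraph ℕ) (n : ℕ) (f : ℕ → V) (b : Bool) (U : Set V) (hf : PartialCopy G H 0 n f)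
    (hU : Layered G c (k + 2) b U) (hsep : Separated G (f '' Set.Iio n) U) :
    Forces A G c (k + 2) (t + 1) H n := by
  obtain ⟨P, Q, hP, hQ, hPQ, gP, gQ, -⟩ := hU.exists_dominated
  obtain ⟨H₁, n₁, σ₁, S₁, hn₁, hold₁, hnew₁, hcard₁, hcol₁, hplace₁⟩ :=
    ih H n f b P hf gP (hsep.mono subset_rfl hP)
  obtain ⟨g₁, hg₁, hg₁P⟩ := hplace₁ b P gP
  set f₁ : ℕ → V := fun i => if i < n then f i else g₁ i with hf₁
  have hcopy₁ : PartialCopy G H₁ 0 n₁ f₁ :=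
    (hf.congr le_rfl hold₁).glue_separated hg₁ (fun i _ hi => Set.mem_image_of_mem f (Set.mem_Iio.2 hi))
      (fun i hi hi' => (hg₁P i hi hi').1) (hsep.mono subset_rfl hP) hnew₁
  have hsep₁ : Separated G (f₁ '' Set.Iio n₁) Q := by
    rintro _ ⟨i, hi, rfl⟩ q hq
    by_cases h : i < n
    · simp only [hf₁, h, if_true]
      exact hsep _ ⟨i, h, rfl⟩ q (hQ hq)
    · simp only [hf₁, h, if_false]
      exact hPQ _ (hg₁P i (by omega) hi).1 q hq
  obtain ⟨H₂, n₂, σ₂, S₂, hn₂, hold₂, hnew₂, hcard₂, hcol₂, hplace₂⟩ :=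
    ih H₁ n₁ f₁ (!b) Q hcopy₁ gQ hsep₁
  have hold : ∀ i j, i < n → j < n → (H₂.Adj i j ↔ H.Adj i j) := fun i j hi hj =>
    (hold₂ i j (by omega) (by omega)).trans (hold₁ i j hi hj)
  have hnew : ∀ i j, i < n → n ≤ j → j < n₂ → ¬ H₂.Adj i j := by
    intro i j hi hj hj'
    by_cases h : j < n₁
    · rw [hold₂ i j (by omega) h]
      exact hnew₁ i j hi hj h
    · exact hnew₂ i j (by omega) (by omega) hj'
  have hcol₁' : ∀ i, i < n₁ → positionColor A H₂ i = positionColor A H₁ i :=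
    fun i hi => positionColor_congr A hi hold₂
  by_cases hS : S₂ ⊆ S₁
  -- The color sets agree: present a vertex adjacent to the opposite side of both copies.
  · have hSeq : S₂ = S₁ := Finset.eq_of_subset_of_card_le hS (by omega)
    set τ : ℕ → Prop := fun i => n ≤ i ∧ ((i < n₁ ∧ ¬ σ₁ i) ∨ (n₁ ≤ i ∧ σ₂ i)) with hτ
    set H₃ := addVertex H₂ n₂ τ with hH₃
    have hplace₃ : ∀ (b : Bool) (U : Set V), Layered G c (k + 2) b U →
        ∃ g : ℕ → V, PartialCopy G H₃ n (n₂ + 1) g ∧ ∀ i, n ≤ i → i < n₂ + 1 → g i ∈ U ∧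
          ((if i < n₁ then σ₁ i else if i < n₂ then ¬ σ₂ i else True) ↔ c (g i) = b) := by
      intro b' U' hU'
      obtain ⟨P', Q', hP', hQ', hPQ', gP', gQ', r, hr, hcr, hrP, hrQ, hadjP, hadjQ⟩ :=
        hU'.exists_dominated
      obtain ⟨p, hp, hpP⟩ := hplace₁ b' P' gP'
      obtain ⟨q, hq, hqQ⟩ := hplace₂ (!b') Q' gQ'
      have h12 : PartialCopy G H₂ n n₂ (fun i => if i < n₁ then p i else q i) :=
        (hp.congr le_rfl hold₂).glue_separated hq (fun i h h' => (hpP i h h').1)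
          (fun i h h' => (hqQ i h h').1) hPQ' hnew₂
      have hlast : PartialCopy G H₃ n₂ (n₂ + 1) (fun _ => r) := by
        intro i j h1 h2 h3 h4
        obtain rfl : i = j := by omega
        exact ⟨fun _ => rfl, iff_of_false G.irrefl (SimpleGraph.irrefl _)⟩
      refine ⟨_, (h12.congr le_rfl fun i j hi hj => addVertex_adj_old i j hi hj).glue hlast ?_, ?_⟩
      · intro i j hi hi' hj hj'
        obtain rfl : j = n₂ := by omega
        rw [addVertex_adj_new hi']
        by_cases h : i < n₁
        · simp only [h, if_true, hτ, hi, true_and, not_le.2 h, false_and, or_false]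
          obtain ⟨hm, hσ⟩ := hpP i hi h
          refine ⟨fun e => hrP (e ▸ hm), ?_⟩
          rw [hσ]
          constructor
          · intro hadj he
            exact c.valid hadj (he.trans hcr.symm)
          · intro hne
            exact (hadjP _ hm (by cases b' <;> simpa using hne)).symm
        · simp only [h, if_false, hτ, hi, true_and, false_and, false_or, not_lt.1 h]
          obtain ⟨hm, hσ⟩ := hqQ i (not_lt.1 h) hi'
          refine ⟨fun e => hrQ (e ▸ hm), ?_⟩
          rw [hσ]
          constructor
          · intro hadj
            have := c.valid hadj
            rw [hcr] at this
            revert this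
            cases b' <;> simp
          · intro he
            exact (hadjQ _ hm he).symm
      · intro i hi hi'
        by_cases h1 : i < n₁
        · have h2 : i < n₂ := by omega
          simp only [h1, h2, if_true]
          exact ⟨hP' (hpP i hi h1).1, (hpP i hi h1).2⟩
        · by_cases h2 : i < n₂
          · simp only [h1, h2, if_true, if_false]
            refine ⟨hQ' (hqQ i (not_lt.1 h1) h2).1, ?_⟩
            rw [(hqQ i (not_lt.1 h1) h2).2]
            cases b' <;> simp
          · simp only [h1, h2, if_false]
            exact ⟨hr, iff_of_true trivial hcr⟩
    obtain ⟨g, hg, hgU⟩ := hplace₃ b U hU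
    have hcol₂' : ∀ i, i < n₂ → positionColor A H₃ i = positionColor A H₂ i :=
      fun i hi => positionColor_congr A hi fun i j hi hj => addVertex_adj_old i j hi hj
    have hnew₃ : ∀ i j, i < n → n ≤ j → j < n₂ + 1 → ¬ H₃.Adj i j := by
      intro i j hi hj hj'
      by_cases h : j < n₂
      · rw [addVertex_adj_old i j (by omega) h]
        exact hnew i j hi hj h
      · obtain rfl : j = n₂ := by omega
        rw [addVertex_adj_new (by omega)]
        exact fun h => absurd h.1 (by omega)
    have hold₃ : ∀ i j, i < n → j < n → (H₃.Adj i j ↔ H.Adj i j) := fun i j hi hj =>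
      (addVertex_adj_old i j (by omega) (by omega)).trans (hold i j hi hj)
    have hcopy : PartialCopy G H₃ 0 (n₂ + 1) (fun i => if i < n then f i else g i) :=
      (hf.congr le_rfl hold₃).glue_separated hg (fun i _ hi => Set.mem_image_of_mem f (Set.mem_Iio.2 hi))
        (fun i hi hi' => (hgU i hi hi').1) hsep hnew₃
    have hnot : positionColor A H₃ n₂ ∉ S₁ := by
      intro hmem
      rw [← hSeq] at hmem
      obtain ⟨i, hi, hi', hσ, hc⟩ := hcol₂ _ hmem
      rw [← hcol₂' i hi'] at hc
      refine hcopy.positionColor_ne hA (i := i) (j := n₂) (by omega) (by omega) ?_ hc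
      exact (addVertex_adj_new hi').2 ⟨by omega, Or.inr ⟨hi, hσ⟩⟩
    refine ⟨H₃, n₂ + 1, fun i => if i < n₁ then σ₁ i else if i < n₂ then ¬ σ₂ i else True,
      insert (positionColor A H₃ n₂) S₁, by omega, hold₃, hnew₃, ?_, ?_, hplace₃⟩
    · rw [Finset.card_insert_of_notMem hnot, hcard₁]
    · intro s hs
      rcases Finset.mem_insert.1 hs with rfl | hs
      · exact ⟨n₂, by omega, by omega, by simp [not_lt.2 hn₂], rfl⟩
      · obtain ⟨i, hi, hi', hσ, hc⟩ := hcol₁ s hs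
        exact ⟨i, hi, by omega, by simpa [hi'] using hσ,
          by rw [hcol₂' i (by omega), hcol₁' i hi', hc]⟩
  -- A color of the second copy is new: place both copies with the same orientation.
  · obtain ⟨s₀, hs₀, hs₀'⟩ := Finset.not_subset.1 hS
    refine ⟨H₂, n₂, fun i => if i < n₁ then σ₁ i else σ₂ i, insert s₀ S₁, by omega, hold, hnew,
      ?_, ?_, ?_⟩
    · rw [Finset.card_insert_of_notMem hs₀', hcard₁]
    · intro s hs
      rcases Finset.mem_insert.1 hs with rfl | hs
      · obtain ⟨i, hi, hi', hσ, hc⟩ := hcol₂ s hs₀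
        exact ⟨i, by omega, hi', by simpa [not_lt.2 hi] using hσ, hc⟩
      · obtain ⟨i, hi, hi', hσ, hc⟩ := hcol₁ s hs
        exact ⟨i, hi, by omega, by simpa [hi'] using hσ, by rw [hcol₁' i hi', hc]⟩
    · intro b' U' hU'
      obtain ⟨P', Q', hP', hQ', hPQ', gP', gQ'⟩ := hU'.exists_parallel
      obtain ⟨p, hp, hpP⟩ := hplace₁ b' P' gP'
      obtain ⟨q, hq, hqQ⟩ := hplace₂ b' Q' gQ'
      refine ⟨_, (hp.congr le_rfl hold₂).glue_separated hq (fun i h h' => (hpP i h h').1)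
          (fun i h h' => (hqQ i h h').1) hPQ' hnew₂, ?_⟩
      intro i hi hi'
      by_cases h1 : i < n₁
      · simp only [h1, if_true]
        exact ⟨hP' (hpP i hi h1).1, (hpP i hi h1).2⟩
      · simp only [h1, if_false]
        exact ⟨hQ' (hqQ i (not_lt.1 h1) hi').1, (hqQ i (not_lt.1 h1) hi').2⟩

theorem forces_of_layered [Finite V] {A : OnlineAlgorithm ℕ} (hA : A.ColorsProperly G)
    (c : G.Coloring Bool) (t : ℕ) (H : SimpleGraph ℕ) (n : ℕ) (f : ℕ → V) (b : Bool) (U : Set V)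
    (hf : PartialCopy G H 0 n f) (hU : Layered G c (2 * t) b U)
    (hsep : Separated G (f '' Set.Iio n) U) : Forces A G c (2 * t) (t + 1) H n := by
  induction t generalizing H n f b U with
  | zero => exact forces_zero A c H n
  | succ t ih => exact forces_add_two hA c ih H n f b U hf hU hsep

theorem exists_lt_numColors [Finite V] {A : OnlineAlgorithm ℕ} (hA : A.ColorsProperly G)
    (c : G.Coloring Bool) {t : ℕ} {b : Bool} {U : Set V} (hU : Layered G c (2 * t) b U) :
    ∃ (N : ℕ) (π : Fin N ≃ V), t < A.numColors G π := by
  obtain ⟨v⟩ : Nonempty V := by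
    generalize 2 * t = k at hU
    cases k with
    | zero => exact ⟨hU.choose⟩
    | succ k =>
      obtain ⟨-, -, -, -, -, -, -, r, -⟩ := hU
      exact ⟨r⟩
  obtain ⟨H, n, σ, S, -, -, -, hcard, hcol, hplace⟩ :=
    forces_of_layered hA c t ⊥ 0 (fun _ => v) b U (fun i j _ hi => absurd hi (Nat.not_lt_zero i)) hU
      (by rintro _ ⟨i, hi, -⟩; exact absurd hi (Nat.not_lt_zero i))
  obtain ⟨g, hg, -⟩ := hplace b U hU
  obtain ⟨N, π, hπ⟩ := hg.exists_order
  refine ⟨N, π, ?_⟩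
  have hsub : (S : Set ℕ) ⊆ Set.range (A.coloring G π) := by
    intro s hs
    obtain ⟨i, -, hi, -, hc⟩ := hcol s hs
    exact ⟨g i, (hπ A i hi).trans hc⟩
  have := Set.ncard_le_ncard hsub (Set.finite_range _)
  rw [Set.ncard_coe_finset, hcard] at this
  exact this

/-- The position itself, as a color, is a proper on-line coloring, so that the infimum defining
`onlineChromaticNumber` is attained. -/
theorem exists_numColors_le [Finite V] (G : SimpleGraph V) :
    ∃ A : OnlineAlgorithm ℕ, A.ColorsProperly G ∧
      ∀ (n : ℕ) (π : Fin n ≃ V), A.numColors G π ≤ onlineChromaticNumber G := by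
  refine Nat.sInf_mem (s := {k : ℕ | ∃ A : OnlineAlgorithm ℕ, A.ColorsProperly G ∧
    ∀ (n : ℕ) (π : Fin n ≃ V), A.numColors G π ≤ k}) ⟨Nat.card V, fun n _ => n, ?_, ?_⟩
  · intro n π v w hvw h
    exact hvw.ne (π.symm.injective (Fin.ext h))
  · intro n π
    simp only [OnlineAlgorithm.numColors]
    rw [← Set.image_univ, ← Set.ncard_univ]
    exact Set.ncard_image_le Set.finite_univ

/-- A layered structure of depth `2 * t` forces more than `t` colors. -/
theorem lt_onlineChromaticNumber [Finite V] (c : G.Coloring Bool) {t : ℕ} {b : Bool} {U : Set V}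
    (hU : Layered G c (2 * t) b U) : t < onlineChromaticNumber G := by
  obtain ⟨A, hA, hle⟩ := exists_numColors_le G
  obtain ⟨N, π, h⟩ := exists_lt_numColors hA c hU
  exact h.trans_le (hle N π)

end Adversary

/-! ### Connected components of induced subgraphs -/

section Components

variable {V : Type u} (G : SimpleGraph V)

/-- The vertices that can be reached from `u` in the graph induced by `S`. -/
def reachIn (S : Set V) (u : V) : Set V :=
  {w | ((G.induce S).spanningCoe).Reachable u w}

variable {G} {S T : Set V} {u v w x : V}

theorem induce_spanningCoe_adj : (G.induce S).spanningCoe.Adj u w ↔ u ∈ S ∧ w ∈ S ∧ G.Adj u w := by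
  simp only [SimpleGraph.map_adj, SimpleGraph.comap_adj, Function.Embedding.subtype_apply]
  constructor
  · rintro ⟨a, b, h, rfl, rfl⟩
    exact ⟨a.2, b.2, h⟩
  · rintro ⟨hu, hw, h⟩
    exact ⟨⟨u, hu⟩, ⟨w, hw⟩, h, rfl, rfl⟩

theorem self_mem_reachIn : u ∈ reachIn G S u := SimpleGraph.Reachable.refl u

theorem reachIn_symm (h : w ∈ reachIn G S u) : u ∈ reachIn G S w := SimpleGraph.Reachable.symm h

theorem reachIn_trans (h : v ∈ reachIn G S u) (h' : w ∈ reachIn G S v) : w ∈ reachIn G S u :=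
  SimpleGraph.Reachable.trans h h'

theorem mem_reachIn_of_adj (hu : u ∈ S) (hw : w ∈ S) (h : G.Adj u w) : w ∈ reachIn G S u :=
  (induce_spanningCoe_adj.2 ⟨hu, hw, h⟩).reachable

theorem reachIn_mono (h : S ⊆ T) : reachIn G S u ⊆ reachIn G T u := fun _ hw =>
  SimpleGraph.Reachable.mono
    (fun _ _ h' => let ⟨h1, h2, h3⟩ := induce_spanningCoe_adj.1 h'
      induce_spanningCoe_adj.2 ⟨h h1, h h2, h3⟩) hw

theorem reachIn_subset (hu : u ∈ S) : reachIn G S u ⊆ S := by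
  rintro w ⟨p⟩
  induction p with
  | nil => exact hu
  | cons h p ih => exact ih (induce_spanningCoe_adj.1 h).2.1

theorem reachIn_subset_reachIn (h : v ∈ reachIn G S u) : reachIn G S v ⊆ reachIn G S u :=
  fun _ hw => reachIn_trans h hw

theorem separated_reachIn (hu : u ∈ S) (hv : v ∈ S) (h : v ∉ reachIn G S u) :
    Separated G (reachIn G S u) (reachIn G S v) := by
  intro s hs t ht
  refine ⟨?_, fun hadj => ?_⟩
  · rintro rfl
    exact h (reachIn_trans hs (reachIn_symm ht))
  · exact h (reachIn_trans (reachIn_trans hs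
      (mem_reachIn_of_adj (reachIn_subset hu hs) (reachIn_subset hv ht) hadj)) (reachIn_symm ht))

/-- A vertex `v` that is connected to `w` through `S` has a neighbor in the component of `w` in
`S`. -/
theorem exists_adj_of_mem_reachIn_insert (hw : w ≠ v) (h : w ∈ reachIn G (insert v S) v) :
    ∃ b ∈ reachIn G S w, G.Adj v b := by
  have key : ∀ {a z : V}, ((G.induce (insert v S)).spanningCoe).Walk a z → z = v → a ≠ v →
      ∃ b ∈ reachIn G S a, G.Adj v b := by
    intro a z p
    induction p with
    | nil => exact fun h h' => absurd h h'
    | @cons a b _ h p ih =>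
      intro hz ha
      obtain ⟨h1, h2, h3⟩ := induce_spanningCoe_adj.1 h
      by_cases hb : b = v
      · subst hb
        exact ⟨a, self_mem_reachIn, h3.symm⟩
      · obtain ⟨d, hd, hd'⟩ := ih hz hb
        exact ⟨d, reachIn_trans (mem_reachIn_of_adj (h1.resolve_left ha) (h2.resolve_left hb) h3) hd,
          hd'⟩
  obtain ⟨p⟩ := reachIn_symm h
  exact key p rfl hw

/-- A connected set with at least two vertices has no isolated vertices. -/
theorem exists_adj_mem_reachIn (hx : x ∈ reachIn G S u) (hw : w ∈ reachIn G S u) (hxw : x ≠ w) :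
    ∃ y ∈ reachIn G S u, G.Adj x y := by
  obtain ⟨p⟩ := reachIn_trans (reachIn_symm hx) hw
  cases p with
  | nil => exact absurd rfl hxw
  | cons h p =>
    obtain ⟨h1, h2, h3⟩ := induce_spanningCoe_adj.1 h
    exact ⟨_, reachIn_trans hx (mem_reachIn_of_adj h1 h2 h3), h3⟩

theorem mem_reachIn_reachIn (h : w ∈ reachIn G S u) :
    w ∈ reachIn G (reachIn G S u) u := by
  obtain ⟨p⟩ := h
  induction p with
  | nil => exact self_mem_reachIn
  | @cons a b w h p ih =>
    have hb : b ∈ reachIn G S a := h.reachable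
    exact reachIn_trans (mem_reachIn_of_adj self_mem_reachIn hb (induce_spanningCoe_adj.1 h).2.2)
      (reachIn_mono (reachIn_subset_reachIn hb) ih)

theorem mem_reachIn_reachIn' (hv : v ∈ reachIn G S u)
    (hw : w ∈ reachIn G S u) : w ∈ reachIn G (reachIn G S u) v :=
  reachIn_trans (reachIn_symm (mem_reachIn_reachIn hv)) (mem_reachIn_reachIn hw)

end Components

/-! ### Induced paths -/

section InducedPaths

variable {V : Type u} (G : SimpleGraph V)

/-- The vertices of the list form, in this order, an induced path of `G`. -/
def IsInducedPath : List V → Prop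
  | [] => True
  | u :: l => (∀ v ∈ l.head?, G.Adj u v) ∧ (∀ w ∈ l.tail, u ≠ w ∧ ¬ G.Adj u w) ∧ IsInducedPath l

variable {G}

theorem IsInducedPath.of_append_right {l₁ l₂ : List V} (h : IsInducedPath G (l₁ ++ l₂)) :
    IsInducedPath G l₂ := by
  induction l₁ with
  | nil => exact h
  | cons a l ih => exact ih h.2.2

theorem IsInducedPath.of_append_left {l₁ l₂ : List V} (h : IsInducedPath G (l₁ ++ l₂)) :
    IsInducedPath G l₁ := by
  induction l₁ with
  | nil => trivial
  | cons a l ih =>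
    refine ⟨fun v hv => h.1 v ?_, fun w hw => h.2.1 w ?_, ih h.2.2⟩
    · cases l with
      | nil => simp at hv
      | cons b l => simpa using hv
    · cases l with
      | nil => simp at hw
      | cons b l => exact List.mem_append_left _ hw

/-- Two induced paths that start at `a` and are otherwise separated form one induced path. -/
theorem IsInducedPath.glue {a : V} {p q : List V} (hp : IsInducedPath G (a :: p))
    (hq : IsInducedPath G (a :: q)) (h : ∀ x ∈ p, ∀ y ∈ q, x ≠ y ∧ ¬ G.Adj x y) :
    IsInducedPath G (p.reverse ++ a :: q) := by
  induction p generalizing a q with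
  | nil => exact hq
  | cons b p ih =>
    have hab : G.Adj a b := hp.1 b rfl
    rw [List.reverse_cons, List.append_assoc]
    refine ih hp.2.2 ⟨?_, ?_, hq⟩ ?_
    · rintro v hv
      obtain rfl : a = v := by simpa using hv
      exact hab.symm
    · intro w hw
      exact h b List.mem_cons_self w hw
    · intro x hx y hy
      rcases List.mem_cons.1 hy with rfl | hy
      · have := hp.2.1 x hx
        exact ⟨this.1.symm, fun e => this.2 e.symm⟩
      · exact h x (List.mem_cons_of_mem _ hx) y hy

theorem IsInducedPath.reverse {l : List V} (h : IsInducedPath G l) : IsInducedPath G l.reverse := by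
  cases l with
  | nil => trivial
  | cons a p =>
    rw [List.reverse_cons]
    exact h.glue ⟨by simp, by simp, trivial⟩ (by simp)

theorem IsInducedPath.adj_getElem_iff {l : List V} (h : IsInducedPath G l) {i j : ℕ} (hij : i < j)
    (hj : j < l.length) :
    l[i] ≠ l[j] ∧ (G.Adj l[i] l[j] ↔ j = i + 1) := by
  induction l generalizing i j with
  | nil => simp at hj
  | cons a l ih =>
    obtain ⟨j, rfl⟩ : ∃ k, j = k + 1 := ⟨j - 1, by omega⟩
    cases i with
    | succ i =>
      have := ih h.2.2 (i := i) (j := j) (by omega) (by simpa using hj)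
      simpa using this
    | zero =>
      cases l with
      | nil => simp at hj
      | cons b l =>
        cases j with
        | zero =>
          have : G.Adj a b := h.1 b rfl
          simp [this, this.ne]
        | succ j =>
          have := h.2.1 (l[j]'(by simpa using hj)) (List.getElem_mem _)
          simp [this.1, this.2]

theorem IsInducedPath.isIndContained {l : List V} (h : IsInducedPath G l) :
    (SimpleGraph.pathGraph l.length).IsIndContained G := by
  have hinj : Function.Injective (fun i : Fin l.length => l[(i : ℕ)]) := by
    intro i j hij
    rcases lt_trichotomy i j with hlt | heq | hlt
    · exact absurd hij (h.adj_getElem_iff hlt j.2).1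
    · exact heq
    · exact absurd hij.symm (h.adj_getElem_iff hlt i.2).1
  refine ⟨⟨⟨_, hinj⟩, fun {i j} => ?_⟩⟩
  change G.Adj l[(i : ℕ)] l[(j : ℕ)] ↔ _
  rw [SimpleGraph.pathGraph_adj]
  rcases lt_trichotomy i j with hlt | heq | hlt
  · rw [(h.adj_getElem_iff hlt j.2).2]
    have : (i : ℕ) < j := hlt
    omega
  · subst heq
    simp
  · rw [G.adj_comm, (h.adj_getElem_iff hlt i.2).2]
    have : (j : ℕ) < i := hlt
    omega

/-- Prepending a vertex with a neighbor on an induced path gives an induced path, after cutting off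
what comes before the last neighbor. -/
theorem IsInducedPath.exists_cons {l : List V} (h : IsInducedPath G l) {u x : V} (hx : x ∈ l)
    (hux : G.Adj u x) (hu : u ∉ l) :
    ∃ l₁ l₂ : List V, l = l₁ ++ l₂ ∧ l₂ ≠ [] ∧ IsInducedPath G (u :: l₂) := by
  induction l generalizing x with
  | nil => simp at hx
  | cons a l ih =>
    by_cases hl : ∃ y ∈ l, G.Adj u y
    · obtain ⟨y, hy, huy⟩ := hl
      obtain ⟨l₁, l₂, rfl, h2, h3⟩ := ih h.2.2 hy huy (fun hm => hu (List.mem_cons_of_mem _ hm))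
      exact ⟨a :: l₁, l₂, rfl, h2, h3⟩
    · obtain rfl : x = a := by
        rcases List.mem_cons.1 hx with rfl | hx
        · rfl
        · exact absurd ⟨x, hx, hux⟩ hl
      refine ⟨[], x :: l, rfl, by simp, ?_, ?_, h⟩
      · intro v hv
        obtain rfl : x = v := by simpa using hv
        exact hux
      · intro w hw
        exact ⟨fun e => hu (e ▸ List.mem_cons_of_mem _ hw), fun e => hl ⟨w, hw, e⟩⟩

/-- If a vertex with property `Q` can be reached from `u` in `S`, then an induced path in `S` leads
from `u` to a vertex with property `Q`, all earlier vertices not having the property. -/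
theorem exists_inducedPath {S : Set V} {u w : V} {Q : V → Prop} (hu : u ∈ S)
    (hw : w ∈ reachIn G S u) (hQ : Q w) :
    ∃ (l : List V) (s : V), IsInducedPath G (l ++ [s]) ∧ (l ++ [s]).head? = some u ∧ Q s ∧ s ∈ S ∧
      ∀ x ∈ l, x ∈ S ∧ ¬ Q x := by
  obtain ⟨p⟩ := hw
  induction p with
  | nil => exact ⟨[], _, ⟨by simp, by simp, trivial⟩, rfl, hQ, hu, by simp⟩
  | @cons a b w h p ih =>
    obtain ⟨h1, h2, h3⟩ := induce_spanningCoe_adj.1 h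
    by_cases hQa : Q a
    · exact ⟨[], a, ⟨by simp, by simp, trivial⟩, rfl, hQa, hu, by simp⟩
    obtain ⟨l, s, hl, hhead, hs, hsS, hlQ⟩ := ih h2 hQ
    by_cases ha : a ∈ l ++ [s]
    · have hal : a ∈ l := by
        rcases List.mem_append.1 ha with h | h
        · exact h
        · obtain rfl := List.mem_singleton.1 h
          exact absurd hs hQa
      obtain ⟨l₁, l₂, rfl⟩ := List.append_of_mem hal
      rw [List.append_assoc] at hl
      exact ⟨a :: l₂, s, hl.of_append_right, rfl, hs, hsS,
        fun x hx => hlQ x (List.mem_append_right _ hx)⟩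
    · have hb : b ∈ l ++ [s] := List.mem_of_mem_head? hhead
      obtain ⟨l₁, l₂, he, hne, h4⟩ := hl.exists_cons hb h3 ha
      obtain ⟨l₃, s', rfl⟩ : ∃ l₃ s', l₂ = l₃ ++ [s'] :=
        ⟨_, _, (List.dropLast_append_getLast hne).symm⟩
      rw [← List.append_assoc] at he
      obtain ⟨rfl, he'⟩ := List.append_inj' he rfl
      obtain rfl : s = s' := by simpa using he'
      refine ⟨a :: l₃, s, h4, rfl, hs, hsS, ?_⟩
      intro x hx
      rcases List.mem_cons.1 hx with rfl | hx
      · exact ⟨hu, hQa⟩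
      · exact hlQ x (List.mem_append_right _ hx)

/-- No induced path on five vertices starts at `v` and continues in `K`. -/
def NoLongPath (G : SimpleGraph V) (v : V) (K : Set V) : Prop :=
  ∀ p : List V, (∀ x ∈ p, x ∈ K) → IsInducedPath G (v :: p) → p.length < 4

/-- In a graph without induced path on nine vertices, of two separated sets at most one contains a
continuation of `v` to an induced path on five vertices. -/
theorem noLongPath_or_noLongPath (hG : ¬ (SimpleGraph.pathGraph 9).IsIndContained G) {K₁ K₂ : Set V}
    (h : Separated G K₁ K₂) (v : V) : NoLongPath G v K₁ ∨ NoLongPath G v K₂ := by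
  by_contra hcon
  simp only [NoLongPath, not_or, not_forall, not_lt] at hcon
  obtain ⟨⟨p, hp, hpi, hpl⟩, ⟨q, hq, hqi, hql⟩⟩ := hcon
  have hp' : IsInducedPath G (v :: p.take 4) := by
    rw [← List.take_append_drop 4 p] at hpi
    exact IsInducedPath.of_append_left (l₁ := v :: p.take 4) hpi
  have hq' : IsInducedPath G (v :: q.take 4) := by
    rw [← List.take_append_drop 4 q] at hqi
    exact IsInducedPath.of_append_left (l₁ := v :: q.take 4) hqi
  have := (hp'.glue hq' fun x hx y hy =>
    h x (hp x (List.mem_of_mem_take hx)) y (hq y (List.mem_of_mem_take hy))).isIndContained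
  have hlen : ((p.take 4).reverse ++ v :: q.take 4).length = 9 := by
    simp [hpl, hql]
  rw [hlen] at this
  exact hG this

theorem IsInducedPath.head_notMem_tail {l : List V} {v : V} (hl : IsInducedPath G l)
    (hv : l.head? = some v) : v ∉ l.tail := by
  intro hm
  cases l with
  | nil => simp at hv
  | cons a p =>
    obtain rfl : a = v := by simpa using hv
    cases p with
    | nil => simp at hm
    | cons b p =>
      rcases List.mem_cons.1 hm with h | h
      · exact (hl.1 b rfl).ne h
      · exact (hl.2.1 a h).1 rfl

theorem NoLongPath.length_le {v : V} {K : Set V} (h : NoLongPath G v K) {l : List V}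
    (hl : IsInducedPath G l) (hv : l.head? = some v) (hK : ∀ x ∈ l, x ∈ insert v K) :
    l.length ≤ 4 := by
  have hnot := hl.head_notMem_tail hv
  cases l with
  | nil => simp at hv
  | cons a p =>
    obtain rfl : a = v := by simpa using hv
    have := h p (fun x hx => (hK x (List.mem_cons_of_mem _ hx)).resolve_left
      (fun e => hnot (e ▸ hx))) hl
    simp
    omega

/-- An induced path between two nonadjacent vertices of opposite sides has at least four vertices.
-/
theorem IsInducedPath.three_le_length (c : G.Coloring Bool) {l : List V} {u s : V}
    (h : IsInducedPath G (l ++ [s])) (hu : (l ++ [s]).head? = some u) (hc : c s ≠ c u)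
    (hadj : ¬ G.Adj u s) : 3 ≤ l.length := by
  match l with
  | [] =>
    obtain rfl : s = u := by simpa using hu
    exact absurd rfl hc
  | [a] =>
    obtain rfl : a = u := by simpa using hu
    exact absurd (h.1 s rfl) hadj
  | [a, p] =>
    obtain rfl : a = u := by simpa using hu
    have h1 := c.valid (h.1 p rfl)
    have h2 := c.valid (h.2.2.1 s rfl)
    revert h1 h2 hc
    cases c a <;> cases c p <;> cases c s <;> simp
  | _ :: _ :: _ :: l => simp

/-- Suppose that no induced path on five vertices leads from `v` into the connected set `K`. Let `z
∈ K` merge two components of `T` into the set `Z ⊆ K`, and let no vertex of `K` and not `v` either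
be universal to `Z`. If `v` and `z` are on opposite sides then they are adjacent. For otherwise `v`
has a neighbor in `Z`, since an induced path from `v` that ends in a neighbor of `Z` could be
continued to a vertex of `Z` at distance at least three; and then an induced path from `v` to `z`
can be continued into a component of `T` that it avoids. -/
theorem NoLongPath.adj (c : G.Coloring Bool) {K : Set V} {v : V}
    (hK : ∀ x ∈ K, x ∈ reachIn G (insert v K) v) (hlong : NoLongPath G v K) {z : V} {T : Set V}
    (hZK : reachIn G (insert z T) z ⊆ K) {a₁ a₂ : V} (h₁ : a₁ ∈ T) (hz₁ : G.Adj z a₁)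
    (h₂ : a₂ ∈ T) (hz₂ : G.Adj z a₂) (h₁₂ : a₂ ∉ reachIn G T a₁)
    (huniv : ∀ s ∈ insert v K, ∃ z' ∈ reachIn G (insert z T) z, c z' ≠ c s ∧ ¬ G.Adj s z')
    (hcz : c z ≠ c v) : G.Adj v z := by
  by_contra hvz
  set Z := reachIn G (insert z T) z with hZ
  have hzZ : z ∈ Z := self_mem_reachIn
  have hTZ : ∀ {a : V}, a ∈ T → G.Adj z a → a ∈ Z := fun ha h =>
    mem_reachIn_of_adj (Set.mem_insert _ _) (Set.mem_insert_of_mem _ ha) h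
  -- `v` has a neighbor in `Z`
  have hQ : ∃ b ∈ Z, G.Adj v b := by
    by_contra hno
    obtain ⟨l, s, hl, hhead, ⟨y, hy, hsy⟩, hsK, hlQ⟩ :=
      exists_inducedPath (G := G) (Q := fun x => ∃ y ∈ Z, G.Adj x y) (Set.mem_insert v K)
        (hK z (hZK hzZ)) ⟨a₁, hTZ h₁ hz₁, hz₁⟩
    have hlne : l ≠ [] := by
      rintro rfl
      obtain rfl : s = v := by simpa using hhead
      exact hno ⟨y, hy, hsy⟩
    have hrev : IsInducedPath G (s :: l.reverse) := by simpa using hl.reverse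
    have hlZ : ∀ x ∈ l, x ∉ Z := fun x hx hxZ => (hlQ x hx).2
      (by
        by_cases hxz : x = z
        · subst hxz
          exact ⟨a₁, hTZ h₁ hz₁, hz₁⟩
        · exact exists_adj_mem_reachIn hxZ hzZ hxz)
    have hsZ : s ∉ Z := by
      intro hs
      obtain ⟨p, q, hpq⟩ := List.exists_cons_of_ne_nil (List.reverse_ne_nil_iff.2 hlne)
      have hp : p ∈ l := by
        rw [← List.mem_reverse, hpq]
        exact List.mem_cons_self
      rw [hpq] at hrev
      exact (hlQ p hp).2 ⟨s, hs, (hrev.1 p rfl).symm⟩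
    obtain ⟨z', hz', hcz', hsz'⟩ := huniv s hsK
    obtain ⟨l₂, y₂, hl₂, hhead₂, hy₂, -, hl₂Z⟩ :=
      exists_inducedPath (G := G) (S := insert s Z) (Q := fun x => x = z') (Set.mem_insert s Z)
        (reachIn_trans (mem_reachIn_of_adj (Set.mem_insert _ _) (Set.mem_insert_of_mem _ hy) hsy)
          (reachIn_mono (Set.subset_insert _ _) (mem_reachIn_reachIn' hy hz'))) rfl
    rw [hy₂] at hl₂ hhead₂
    have hlen := hl₂.three_le_length c hhead₂ hcz' hsz'
    obtain ⟨t, ht⟩ : ∃ t, l₂ ++ [z'] = s :: t := by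
      cases hl : l₂ ++ [z'] with
      | nil => simp at hl
      | cons a t =>
        rw [hl] at hhead₂
        obtain rfl : a = s := by simpa using hhead₂
        exact ⟨t, rfl⟩
    have hst := hl₂.head_notMem_tail hhead₂
    have htlen : l₂.length + 1 = t.length + 1 := by simpa using congrArg List.length ht
    rw [ht] at hl₂ hst
    have htZ : ∀ x ∈ t, x ∈ Z := by
      intro x hx
      have hx' : x ∈ l₂ ++ [z'] := ht ▸ List.mem_cons_of_mem _ hx
      rcases List.mem_append.1 hx' with h | h
      · exact (hl₂Z x h).1.resolve_left (fun e => hst (e ▸ hx))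
      · exact (List.mem_singleton.1 h) ▸ hz'
    have hpath := hrev.glue hl₂ fun x hx y hy =>
      ⟨fun e => hlZ x (List.mem_reverse.1 hx) (e ▸ htZ y hy),
        fun e => (hlQ x (List.mem_reverse.1 hx)).2 ⟨y, htZ y hy, e⟩⟩
    rw [List.reverse_reverse] at hpath
    have hlpos := List.length_pos_iff.2 hlne
    have := hlong.length_le hpath (by cases l <;> simp_all) (by
      intro x hx
      rcases List.mem_append.1 hx with h | h
      · exact (hlQ x h).1
      · rcases List.mem_cons.1 h with rfl | h
        · exact hsK
        · exact Set.mem_insert_of_mem _ (hZK (htZ x h)))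
    simp at this
    omega
  obtain ⟨b, hb, hvb⟩ := hQ
  have hbz : b ≠ z := fun e => hvz (e ▸ hvb)
  have hbT : b ∈ T := (reachIn_subset (Set.mem_insert _ _) hb).resolve_left hbz
  have hBZ : reachIn G T b ⊆ Z := fun x hx =>
    reachIn_trans hb (reachIn_mono (Set.subset_insert _ _) hx)
  -- a neighbor of `z` outside the component of `b`
  obtain ⟨a, haT, hza, haB⟩ : ∃ a ∈ T, G.Adj z a ∧ a ∉ reachIn G T b := by
    by_contra hno
    push Not at hno
    exact h₁₂ (reachIn_trans (reachIn_symm (hno a₁ h₁ hz₁)) (hno a₂ h₂ hz₂))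
  obtain ⟨d, hd, hzd⟩ := exists_adj_of_mem_reachIn_insert hbz hb
  obtain ⟨l, y, hl, hhead, hy, -, hlS⟩ :=
    exists_inducedPath (G := G) (S := insert v (insert z (reachIn G T b))) (Q := fun x => x = z)
      (Set.mem_insert _ _) (reachIn_trans (mem_reachIn_of_adj (Set.mem_insert _ _)
        (Or.inr (Or.inr self_mem_reachIn)) hvb) (reachIn_trans (reachIn_mono
          (fun x hx => Or.inr (Or.inr hx)) (mem_reachIn_reachIn hd))
          (mem_reachIn_of_adj (Or.inr (Or.inr hd)) (Or.inr (Or.inl rfl)) hzd.symm))) rfl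
  rw [hy] at hl hhead
  have hlen := hl.three_le_length c hhead hcz hvz
  have hrev : IsInducedPath G (z :: l.reverse) := by simpa using hl.reverse
  have hlB : ∀ x ∈ l, x = v ∨ x ∈ reachIn G T b := fun x hx =>
    (hlS x hx).1.imp id (fun h => h.resolve_left (hlS x hx).2)
  have hca : c a = c v := by
    have := c.valid hza
    revert this hcz
    cases c a <;> cases c v <;> cases c z <;> simp
  have hpath := hrev.glue (q := [a]) ⟨by simpa using hza, by simp, by simp, by simp, trivial⟩ (by
    intro x hx y hy
    obtain rfl := List.mem_singleton.1 hy
    rcases hlB x (List.mem_reverse.1 hx) with rfl | hx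
    · refine ⟨?_, fun e => c.valid e hca.symm⟩
      rintro rfl
      exact hvz hza.symm
    · exact separated_reachIn hbT haT haB x hx y self_mem_reachIn)
  rw [List.reverse_reverse] at hpath
  have := hlong.length_le hpath (by cases l <;> simp_all) (by
    intro x hx
    rcases List.mem_append.1 hx with h | h
    · exact (hlB x h).imp id (fun h => hZK (hBZ h))
    · rcases List.mem_cons.1 h with rfl | h
      · exact Or.inr (hZK hzZ)
      · exact Or.inr (hZK (List.mem_singleton.1 h ▸ hTZ haT hza)))
  simp at this
  omega

end InducedPaths

/-! ### The algorithm on a fixed presentation order -/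

section Transfer

variable {N M : ℕ} (h : N ≤ M) (H : SimpleGraph (Fin M)) (col : Fin M → Option Color)

theorem castLE_mem_levelSet {i : ℕ} {v w : Fin N} :
    Fin.castLE h w ∈ levelSet col i (Fin.castLE h v) ↔
      w ∈ levelSet (col ∘ Fin.castLE h) i v := by
  simp [levelSet, Fin.castLE_inj]

/-- Walks in the graph seen so far are walks in the whole graph. -/
def levelGraphHom (i : ℕ) (v : Fin N) :
    levelGraph (H.comap (Fin.castLE h)) (col ∘ Fin.castLE h) i v →g
      levelGraph H col i (Fin.castLE h v) where
  toFun := Fin.castLE h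
  map_rel' := by
    intro a b hab
    obtain ⟨h1, h2, h3⟩ := induce_spanningCoe_adj.1 hab
    exact induce_spanningCoe_adj.2
      ⟨(castLE_mem_levelSet h col).2 h1, (castLE_mem_levelSet h col).2 h2, h3⟩

theorem exists_walk_of_walk_castLE {i : ℕ} {v a' : Fin N} {a w : Fin M}
    (p : (levelGraph H col i (Fin.castLE h v)).Walk a w) (ha : a = Fin.castLE h a') :
    ∃ w' : Fin N, w = Fin.castLE h w' ∧
      ∃ q : (levelGraph (H.comap (Fin.castLE h)) (col ∘ Fin.castLE h) i v).Walk a' w',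
        q.length = p.length := by
  induction p generalizing a' with
  | nil => exact ⟨a', ha, .nil, rfl⟩
  | @cons a b w hab p ih =>
    obtain ⟨h1, h2, h3⟩ := induce_spanningCoe_adj.1 hab
    have hb : (b : ℕ) < N := by
      rcases h2 with rfl | ⟨h2, -⟩
      · exact v.2
      · exact lt_trans h2 v.2
    obtain ⟨b', rfl⟩ : ∃ b', b = Fin.castLE h b' := ⟨⟨b, hb⟩, rfl⟩
    obtain ⟨w', hw, q, hq⟩ := ih rfl
    subst ha
    exact ⟨w', hw, .cons (induce_spanningCoe_adj.2 ⟨(castLE_mem_levelSet h col).1 h1,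
      (castLE_mem_levelSet h col).1 h2, h3⟩) q, congrArg (· + 1) hq⟩

theorem image_ownSide (i : ℕ) (v : Fin N) :
    ownSide H col i (Fin.castLE h v) =
      Fin.castLE h '' ownSide (H.comap (Fin.castLE h)) (col ∘ Fin.castLE h) i v := by
  ext w
  constructor
  · rintro ⟨p, hp⟩
    obtain ⟨w', rfl, q, hq⟩ := exists_walk_of_walk_castLE h H col p rfl
    exact ⟨w', ⟨q, hq ▸ hp⟩, rfl⟩
  · rintro ⟨w', ⟨q, hq⟩, rfl⟩
    exact ⟨q.map (levelGraphHom h H col i v), (congrArg Even (q.length_map _)).mpr hq⟩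

theorem image_otherSide (i : ℕ) (v : Fin N) :
    otherSide H col i (Fin.castLE h v) =
      Fin.castLE h '' otherSide (H.comap (Fin.castLE h)) (col ∘ Fin.castLE h) i v := by
  ext w
  constructor
  · rintro ⟨p, hp⟩
    obtain ⟨w', rfl, q, hq⟩ := exists_walk_of_walk_castLE h H col p rfl
    exact ⟨w', ⟨q, hq ▸ hp⟩, rfl⟩
  · rintro ⟨w', ⟨q, hq⟩, rfl⟩
    exact ⟨q.map (levelGraphHom h H col i v), (congrArg Odd (q.length_map _)).mpr hq⟩

theorem image_component (i : ℕ) (v : Fin N) :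
    component H col i (Fin.castLE h v) =
      Fin.castLE h '' component (H.comap (Fin.castLE h)) (col ∘ Fin.castLE h) i v := by
  ext w
  constructor
  · rintro ⟨p⟩
    obtain ⟨w', rfl, q, -⟩ := exists_walk_of_walk_castLE h H col p rfl
    exact ⟨w', ⟨q⟩, rfl⟩
  · rintro ⟨w', ⟨q⟩, rfl⟩
    exact ⟨q.map (levelGraphHom h H col i v)⟩

theorem nextIndex_comap (v : Fin N) :
    nextIndex (H.comap (Fin.castLE h)) (col ∘ Fin.castLE h) v = nextIndex H col (Fin.castLE h v) := by
  simp [nextIndex, IsMixed, image_ownSide, image_otherSide]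

/-- The color of a vertex depends only on the graph induced by the vertices presented so far. -/
theorem chooseColor_comap (v : Fin N) :
    chooseColor (H.comap (Fin.castLE h)) (col ∘ Fin.castLE h) v =
      chooseColor H col (Fin.castLE h v) := by
  classical
  simp only [chooseColor]
  rw [nextIndex_comap]
  refine if_congr ?_ rfl (if_congr ?_ rfl (if_congr ?_ rfl rfl)) <;>
    simp [image_ownSide, image_otherSide, image_component, HasColorIndex, IsUniversalTo]

end Transfer

/-- The colors of the vertices presented before `v`. -/
def before {n : ℕ} (κ : Fin n → Color) (v w : Fin n) : Option Color :=
  if w < v then some (κ w) else none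

/-- The coloring of a presented graph satisfies the recursion of the algorithm within the whole
graph. -/
theorem coloring_eq_chooseColor {V : Type u} {n : ℕ} (G : SimpleGraph V) (π : Fin n ≃ V) (v : Fin n) :
    algorithm1.coloring G π (π v) =
      chooseColor (G.comap π) (before (fun w => algorithm1.coloring G π (π w)) v) v := by
  have hcol : ∀ w : Fin n, algorithm1.coloring G π (π w) = algorithm1 w.val (presented G π w) := by
    intro w
    simp only [OnlineAlgorithm.coloring]
    rw [Equiv.symm_apply_apply]
  simp only [hcol]
  have := chooseColor_comap (N := v.val + 1) (M := n) v.isLt (G.comap π)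
    (before (fun w => algorithm1 w.val (presented G π w)) v) (Fin.last v.val)
  have hlast : Fin.castLE v.isLt (Fin.last v.val) = v := Fin.ext rfl
  rw [hlast] at this
  rw [← this, algorithm1]
  congr 1

section Analysis

variable {n : ℕ} {H : SimpleGraph (Fin n)} {κ : Fin n → Color}

/-- The vertices presented before `v` whose color has subscript at most `l`. -/
def below (κ : Fin n → Color) (l : ℕ) (v : Fin n) : Set (Fin n) :=
  {w | w < v ∧ (κ w).subscript ≤ l}

/-- The vertex set of `C_l[v]`, in terms of the final coloring `κ` of all vertices. -/
def comp (H : SimpleGraph (Fin n)) (κ : Fin n → Color) (l : ℕ) (v : Fin n) : Set (Fin n) :=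
  reachIn H (insert v (below κ l v)) v

/-- The vertex `x` is universal to `C_l[u]`, the sides being given by the bipartition `c`. -/
def UniversalTo (H : SimpleGraph (Fin n)) (κ : Fin n → Color) (c : Fin n → Bool) (x : Fin n) (l : ℕ)
    (u : Fin n) : Prop :=
  (∀ w ∈ comp H κ l u, c w = c u → H.Adj x w) ∨ ∀ w ∈ comp H κ l u, c w ≠ c u → H.Adj x w

/-- The condition of the third rule of the algorithm. -/
def HasUniversal (H : SimpleGraph (Fin n)) (κ : Fin n → Color) (c : Fin n → Bool) (m : ℕ)
    (v : Fin n) : Prop :=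
  ∃ u ∈ comp H κ m v, ∃ u' ∈ comp H κ m v, c u' ≠ c v ∧ ∃ j : ℕ, u < v ∧ (κ u = .a j ∨ κ u = .b j) ∧
    (m : ℝ) - Real.sqrt (2 * (m : ℝ)) + 2 ≤ (j : ℝ) ∧ UniversalTo H κ c u' (j - 1) u

theorem mem_comp_self {l : ℕ} {v : Fin n} : v ∈ comp H κ l v := self_mem_reachIn

theorem eq_or_mem_below_of_mem_comp {l : ℕ} {v w : Fin n} (h : w ∈ comp H κ l v) :
    w = v ∨ w ∈ below κ l v := reachIn_subset (Set.mem_insert _ _) h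

theorem comp_subset_reachIn {i l : ℕ} {u v : Fin n} (hu : u ∈ below κ l v) (hi : i ≤ l) :
    comp H κ i u ⊆ reachIn H (below κ l v) u := by
  refine reachIn_mono ?_
  rintro w (rfl | ⟨h1, h2⟩)
  · exact hu
  · exact ⟨h1.trans hu.1, h2.trans hi⟩

theorem comp_subset_comp {i l : ℕ} {u v : Fin n} (hu : u ∈ comp H κ l v) (hi : i ≤ l) :
    comp H κ i u ⊆ comp H κ l v := by
  rcases eq_or_mem_below_of_mem_comp hu with rfl | hu'
  · refine reachIn_mono (Set.insert_subset_insert ?_)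
    exact fun w hw => ⟨hw.1, hw.2.trans hi⟩
  · exact fun w hw => reachIn_trans hu
      (reachIn_mono (Set.subset_insert _ _) (comp_subset_reachIn hu' hi hw))

theorem before_eq_some {v w : Fin n} {x : Color} : before κ v w = some x ↔ w < v ∧ κ w = x := by
  simp only [before]
  split_ifs with h <;> simp [h]

theorem levelSet_before {l : ℕ} {u v : Fin n} (hu : u ≤ v) :
    levelSet (before κ v) l u = insert u (below κ l u) := by
  ext w
  simp only [levelSet, before_eq_some, Set.mem_ofPred_eq, below, Set.mem_insert_iff]
  refine or_congr Iff.rfl (and_congr_right fun hw => ?_)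
  exact ⟨fun ⟨x, h1, h2⟩ => h1.2 ▸ h2, fun h => ⟨κ w, ⟨hw.trans_le hu, rfl⟩, h⟩⟩

theorem component_before {l : ℕ} {u v : Fin n} (hu : u ≤ v) :
    component H (before κ v) l u = comp H κ l u := by
  simp only [comp, ← levelSet_before hu]
  rfl

/-- The bipartition of `H` restricts to a bipartition of the subgraph `G_i[v]`. -/
def levelColoring (c : H.Coloring Bool) (col : Fin n → Option Color) (l : ℕ) (v : Fin n) :
    (levelGraph H col l v).Coloring Bool :=
  SimpleGraph.Coloring.mk c fun h => c.valid (induce_spanningCoe_adj.1 h).2.2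

theorem mem_ownSide_before (c : H.Coloring Bool) {l : ℕ} {u v w : Fin n} (hu : u ≤ v) :
    w ∈ ownSide H (before κ v) l u ↔ w ∈ comp H κ l u ∧ c w = c u := by
  rw [← component_before hu]
  constructor
  · rintro ⟨p, hp⟩
    have h := ((levelColoring c _ l u).even_length_iff_congr p).1 hp
    exact ⟨⟨p⟩, (Bool.eq_iff_iff.2 h).symm⟩
  · rintro ⟨⟨p⟩, hc⟩
    exact ⟨p, ((levelColoring c _ l u).even_length_iff_congr p).2 (Bool.eq_iff_iff.1 hc.symm)⟩

theorem mem_otherSide_before (c : H.Coloring Bool) {l : ℕ} {u v w : Fin n} (hu : u ≤ v) :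
    w ∈ otherSide H (before κ v) l u ↔ w ∈ comp H κ l u ∧ c w ≠ c u := by
  rw [← component_before hu]
  constructor
  · rintro ⟨p, hp⟩
    refine ⟨⟨p⟩, fun h => Nat.not_even_iff_odd.2 hp ?_⟩
    exact ((levelColoring c _ l u).even_length_iff_congr p).2 (Bool.eq_iff_iff.1 h.symm)
  · rintro ⟨⟨p⟩, hc⟩
    refine ⟨p, Nat.not_even_iff_odd.1 fun h => hc ?_⟩
    exact (Bool.eq_iff_iff.2 (((levelColoring c _ l u).even_length_iff_congr p).1 h)).symm

theorem lt_of_mem_comp_of_ne {c : Fin n → Bool} {l : ℕ} {v w : Fin n} (h : w ∈ comp H κ l v)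
    (hc : c w ≠ c v) : w < v :=
  ((eq_or_mem_below_of_mem_comp h).resolve_left fun e => hc (e ▸ rfl)).1

theorem isMixed_before (c : H.Coloring Bool) {i : ℕ} {v : Fin n} :
    IsMixed H (before κ v) i v ↔ (∃ x ∈ comp H κ i v, c x = c v ∧ x < v ∧ κ x = .a i) ∧
      ∃ y ∈ comp H κ i v, c y ≠ c v ∧ κ y = .a i := by
  simp only [IsMixed, mem_ownSide_before c le_rfl, mem_otherSide_before c le_rfl, before_eq_some,
    and_assoc]
  refine and_congr Iff.rfl (exists_congr fun y => ?_)
  refine and_congr_right fun h1 => and_congr_right fun h2 => ?_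
  exact and_iff_right (lt_of_mem_comp_of_ne h1 h2)

theorem exists_otherSide_before (c : H.Coloring Bool) {m : ℕ} {v : Fin n} {x : Color} :
    (∃ w ∈ otherSide H (before κ v) m v, before κ v w = some x) ↔
      ∃ w ∈ comp H κ m v, c w ≠ c v ∧ κ w = x := by
  simp only [mem_otherSide_before c le_rfl, before_eq_some, and_assoc]
  refine exists_congr fun w => and_congr_right fun h1 => and_congr_right fun h2 => ?_
  exact and_iff_right (lt_of_mem_comp_of_ne h1 h2)

theorem isUniversalTo_before (c : H.Coloring Bool) {l : ℕ} {u v x : Fin n} (hu : u ≤ v) :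
    IsUniversalTo H (before κ v) x l u ↔ UniversalTo H κ c x l u := by
  simp only [IsUniversalTo, UniversalTo, mem_ownSide_before c hu, mem_otherSide_before c hu, and_imp]

theorem hasUniversal_before (c : H.Coloring Bool) {m : ℕ} {v : Fin n} :
    (∃ u ∈ component H (before κ v) m v, ∃ u' ∈ otherSide H (before κ v) m v, ∃ j : ℕ,
      HasColorIndex (before κ v) u j ∧ (m : ℝ) - Real.sqrt (2 * (m : ℝ)) + 2 ≤ (j : ℝ) ∧
        IsUniversalTo H (before κ v) u' (j - 1) u) ↔ HasUniversal H κ c m v := by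
  simp only [component_before le_rfl, mem_otherSide_before c le_rfl, HasUniversal, HasColorIndex,
    before_eq_some, and_assoc]
  refine exists_congr fun u => and_congr_right fun _ => exists_congr fun u' =>
    and_congr_right fun _ => and_congr_right fun _ => exists_congr fun j => ?_
  constructor
  · rintro ⟨h1, h2, h3⟩
    have hu : u < v := by rcases h1 with h | h <;> exact h.1
    exact ⟨hu, h1.imp And.right And.right, h2, (isUniversalTo_before c hu.le).1 h3⟩
  · rintro ⟨hu, h1, h2, h3⟩
    exact ⟨h1.imp (And.intro hu) (And.intro hu), h2, (isUniversalTo_before c hu.le).2 h3⟩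

open Classical in
theorem chooseColor_before (c : H.Coloring Bool) {m : ℕ} {v : Fin n}
    (hm : nextIndex H (before κ v) v = m) :
    chooseColor H (before κ v) v =
      if ∃ w ∈ comp H κ m v, c w ≠ c v ∧ κ w = .a m then .b m
      else if ∃ w ∈ comp H κ m v, c w ≠ c v ∧ κ w = .c m then .a m
      else if HasUniversal H κ c m v then .c m else .a m := by
  simp only [chooseColor]
  rw [hm]
  exact if_congr (exists_otherSide_before c) rfl (if_congr (exists_otherSide_before c) rfl
    (if_congr (hasUniversal_before c) rfl rfl))

/-- `κ` is the coloring of `H`, presented in its natural order, by the algorithm. -/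
def IsGreedy (H : SimpleGraph (Fin n)) (κ : Fin n → Color) : Prop :=
  ∀ v, κ v = chooseColor H (before κ v) v

theorem IsGreedy.subscript_eq (hκ : IsGreedy H κ) (v : Fin n) :
    (κ v).subscript = nextIndex H (before κ v) v := by
  rw [hκ v]
  simp only [chooseColor]
  split_ifs <;> rfl

theorem IsGreedy.one_le_subscript (hκ : IsGreedy H κ) (v : Fin n) : 1 ≤ (κ v).subscript := by
  rw [hκ.subscript_eq]
  exact Nat.le_add_left 1 _

theorem bddAbove_isMixed (v : Fin n) :
    BddAbove {i : ℕ | 1 ≤ i ∧ IsMixed H (before κ v) i v} := by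
  refine ((Set.finite_range fun w => (κ w).subscript).subset ?_).bddAbove
  rintro i ⟨-, ⟨x, -, hx⟩, -⟩
  exact ⟨x, by simp [(before_eq_some.1 hx).2, Color.subscript]⟩

theorem IsGreedy.lt_subscript (hκ : IsGreedy H κ) (c : H.Coloring Bool) {i : ℕ} {v x y : Fin n}
    (hx : x ∈ comp H κ i v) (hcx : c x = c v) (hxv : x < v) (hκx : κ x = .a i)
    (hy : y ∈ comp H κ i v) (hcy : c y ≠ c v) (hκy : κ y = .a i) : i < (κ v).subscript := by
  have hi : 1 ≤ i := by
    have := hκ.one_le_subscript x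
    rwa [hκx] at this
  rw [hκ.subscript_eq]
  refine Nat.lt_succ_of_le (le_csSup (bddAbove_isMixed v) ⟨hi, ?_⟩)
  exact (isMixed_before c).2 ⟨⟨x, hx, hcx, hxv, hκx⟩, y, hy, hcy, hκy⟩

theorem IsGreedy.exists_mixed (hκ : IsGreedy H κ) (c : H.Coloring Bool) {m : ℕ} (hm : 1 ≤ m)
    {v : Fin n} (hv : (κ v).subscript = m + 1) :
    (∃ x ∈ comp H κ m v, c x = c v ∧ x < v ∧ κ x = .a m) ∧
      ∃ y ∈ comp H κ m v, c y ≠ c v ∧ κ y = .a m := by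
  rw [hκ.subscript_eq, nextIndex, Nat.add_right_cancel_iff] at hv
  have hne : {i : ℕ | 1 ≤ i ∧ IsMixed H (before κ v) i v}.Nonempty := by
    by_contra h
    rw [Set.not_nonempty_iff_eq_empty] at h
    rw [h, csSup_empty] at hv
    simp at hv
    omega
  have := Nat.sSup_mem hne (bddAbove_isMixed v)
  rw [hv] at this
  exact (isMixed_before c).1 this.2

theorem IsGreedy.of_eq_a (hκ : IsGreedy H κ) (c : H.Coloring Bool) {m : ℕ} {v : Fin n}
    (hv : κ v = .a m) : (∀ w ∈ comp H κ m v, c w ≠ c v → κ w ≠ .a m) ∧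
      ((∃ w ∈ comp H κ m v, c w ≠ c v ∧ κ w = .c m) ∨ ¬ HasUniversal H κ c m v) := by
  have h := hκ v
  rw [chooseColor_before c (m := m) (by rw [← hκ.subscript_eq, hv]; rfl), hv] at h
  split_ifs at h with h1 h2 h3
  · exact ⟨fun w hw hc ha => h1 ⟨w, hw, hc, ha⟩, Or.inl h2⟩
  · exact ⟨fun w hw hc ha => h1 ⟨w, hw, hc, ha⟩, Or.inr h3⟩

theorem IsGreedy.of_eq_b (hκ : IsGreedy H κ) (c : H.Coloring Bool) {m : ℕ} {v : Fin n}
    (hv : κ v = .b m) : ∃ w ∈ comp H κ m v, c w ≠ c v ∧ κ w = .a m := by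
  have h := hκ v
  rw [chooseColor_before c (m := m) (by rw [← hκ.subscript_eq, hv]; rfl), hv] at h
  split_ifs at h with h1 h2 h3
  exact h1

theorem IsGreedy.of_eq_c (hκ : IsGreedy H κ) (c : H.Coloring Bool) {m : ℕ} {v : Fin n}
    (hv : κ v = .c m) : (∀ w ∈ comp H κ m v, c w ≠ c v → κ w ≠ .c m) ∧ HasUniversal H κ c m v := by
  have h := hκ v
  rw [chooseColor_before c (m := m) (by rw [← hκ.subscript_eq, hv]; rfl), hv] at h
  split_ifs at h with h1 h2 h3
  exact ⟨fun w hw hc ha => h2 ⟨w, hw, hc, ha⟩, h3⟩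

/-- The algorithm colors properly: if `b_m` occurred at both ends of an edge then `a_m` would be
mixed in the component of the later end. -/
theorem IsGreedy.ne_of_adj (hκ : IsGreedy H κ) (c : H.Coloring Bool) {v w : Fin n}
    (h : H.Adj v w) : κ v ≠ κ w := by
  wlog hwv : w < v generalizing v w
  · exact (this h.symm (lt_of_le_of_ne (not_lt.1 hwv) h.ne)).symm
  intro heq
  have hcw : c w ≠ c v := c.valid h.symm
  have hmem : ∀ m, (κ w).subscript = m → w ∈ comp H κ m v := fun m hm =>
    mem_reachIn_of_adj (Set.mem_insert _ _) (Set.mem_insert_of_mem _ ⟨hwv, hm.le⟩) h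
  cases hv : κ v with
  | a m =>
    rw [hv] at heq
    exact (hκ.of_eq_a c hv).1 w (hmem m (by rw [← heq]; rfl)) hcw heq.symm
  | b m =>
    rw [hv] at heq
    have hw := hmem m (by rw [← heq]; rfl)
    obtain ⟨x, hx, hcx, hκx⟩ := hκ.of_eq_b c heq.symm
    obtain ⟨y, hy, hcy, hκy⟩ := hκ.of_eq_b c hv
    have hxv : x < v := (lt_of_mem_comp_of_ne hx hcx).trans hwv
    have := hκ.lt_subscript c (comp_subset_comp hw le_rfl hx)
      (by revert hcx hcw; cases c x <;> cases c w <;> cases c v <;> simp) hxv hκx hy hcy hκy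
    rw [hv] at this
    exact lt_irrefl _ this
  | c m =>
    rw [hv] at heq
    exact (hκ.of_eq_c c hv).1 w (hmem m (by rw [← heq]; rfl)) hcw heq.symm

/-- In a component of the graph induced by the vertices before `v` of subscript at most `l`, all
vertices of color `a_l` are on the same side. Otherwise consider the last vertex of the component:
it either makes `a_l` mixed, and then has a larger subscript, or it has color `a_l` itself in spite
of the first rule. -/
theorem IsGreedy.eq_side (hκ : IsGreedy H κ) (c : H.Coloring Bool) {l : ℕ} {v x y : Fin n}
    (hx : x ∈ below κ l v) (hκx : κ x = .a l) (hκy : κ y = .a l)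
    (hxy : y ∈ reachIn H (below κ l v) x) : c x = c y := by
  by_contra hc
  obtain ⟨z, hz, hmax⟩ := Set.exists_max_image (reachIn H (below κ l v) x) id (Set.toFinite _)
    ⟨x, self_mem_reachIn⟩
  have hsub : reachIn H (below κ l v) x ⊆ comp H κ l z := by
    intro w hw
    refine reachIn_mono ?_ (mem_reachIn_reachIn' hz hw)
    intro w' hw'
    rcases eq_or_lt_of_le (hmax w' hw') with h | h
    · exact Or.inl h
    · exact Or.inr ⟨h, (reachIn_subset hx hw').2⟩
  have hzl := (reachIn_subset hx hz).2
  have key : ∀ x y : Fin n, x ∈ comp H κ l z → y ∈ comp H κ l z → x ≤ z → κ x = .a l →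
      κ y = .a l → c x ≠ c y → c x = c z → False := by
    intro x y hx hy hxz hκx hκy hc hcx
    have hcy : c y ≠ c z := fun h => hc (hcx.trans h.symm)
    rcases eq_or_lt_of_le hxz with rfl | hlt
    · exact (hκ.of_eq_a c hκx).1 y hy hcy hκy
    · exact absurd (hκ.lt_subscript c hx hcx hlt hκx hy hcy hκy) (not_lt.2 hzl)
  by_cases h : c x = c z
  · exact key x y (hsub self_mem_reachIn) (hsub hxy) (hmax x self_mem_reachIn) hκx
      hκy hc h
  · exact key y x (hsub hxy) (hsub self_mem_reachIn) (hmax y hxy) hκy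
      hκx (Ne.symm hc) (by revert hc h; cases c x <;> cases c y <;> cases c z <;> simp)

/-- A vertex of subscript `m + 1` merges two components of subscripts at most `m` which contain
vertices of color `a_m`, on the side of `v` and on the opposite side. -/
theorem IsGreedy.exists_merge (hκ : IsGreedy H κ) (c : H.Coloring Bool) {m : ℕ} (hm : 1 ≤ m)
    {v : Fin n} (hv : (κ v).subscript = m + 1) :
    ∃ x y : Fin n, κ x = .a m ∧ κ y = .a m ∧ c x = c v ∧ c y ≠ c v ∧ x ∈ below κ m v ∧
      y ∈ below κ m v ∧ x ∈ comp H κ m v ∧ y ∈ comp H κ m v ∧ y ∉ reachIn H (below κ m v) x := by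
  obtain ⟨⟨x, hx, hcx, hxv, hκx⟩, y, hy, hcy, hκy⟩ := hκ.exists_mixed c hm hv
  have hxb := (eq_or_mem_below_of_mem_comp hx).resolve_left hxv.ne
  have hyb := (eq_or_mem_below_of_mem_comp hy).resolve_left (lt_of_mem_comp_of_ne hy hcy).ne
  refine ⟨x, y, hκx, hκy, hcx, hcy, hxb, hyb, hx, hy, fun h => ?_⟩
  exact hcy ((hκ.eq_side c hxb hκx hκy h).symm.trans hcx)

end Analysis

/-! ### Large subscripts give deep layered structures -/

section Structure

variable {n : ℕ} {H : SimpleGraph (Fin n)} {κ : Fin n → Color}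

theorem Layered.succ_of_complete {V : Type u} {G : SimpleGraph V} {c : V → Bool} {k : ℕ} {b : Bool}
    {U U₁ U₂ : Set V} (h₁ : U₁ ⊆ U) (h₂ : U₂ ⊆ U) (hs : Separated G U₁ U₂) (g₁ : Layered G c k b U₁)
    (g₂ : Layered G c k (!b) U₂) {r : V} (hr : r ∈ U) (hcr : c r = b)
    (hadj : ∀ w, w ∈ U₁ ∨ w ∈ U₂ → c w = !b → G.Adj r w) : Layered G c (k + 1) b U := by
  refine ⟨U₁, U₂, h₁, h₂, hs, g₁, g₂, r, hr, hcr, ?_⟩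
  by_cases hr₁ : r ∈ U₁
  · exact Or.inr ⟨fun hr₂ => (hs r hr₁ r hr₂).1 rfl, fun w hw => hadj w (Or.inr hw)⟩
  · exact Or.inl ⟨hr₁, fun w hw => hadj w (Or.inl hw)⟩

/-- A vertex `u'` that is universal to the component of a merging vertex `u` is the root of a
layered structure, whatever its side: the two merged components contain structures of both
orientations. -/
theorem IsGreedy.layered_of_universalTo (hκ : IsGreedy H κ) (c : H.Coloring Bool) {k l : ℕ}
    {u u' : Fin n} {U : Set (Fin n)} (hl : 1 ≤ l) (hu : (κ u).subscript = l + 1)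
    (huniv : UniversalTo H κ c u' l u)
    (ih : ∀ x, κ x = .a l → Layered H c k (c x) (comp H κ l x)) (hU : comp H κ l u ⊆ U)
    (hu' : u' ∈ U) : Layered H c (k + 1) (c u') U := by
  obtain ⟨x, y, hκx, hκy, hcx, hcy, hxb, hyb, hx, hy, hxy⟩ := hκ.exists_merge c hl hu
  have hadj : ∀ w ∈ comp H κ l u, c w = !(c u') → H.Adj u' w := by
    intro w hw hcw
    rcases huniv with h | h
    · have h1 := c.valid (h u mem_comp_self rfl)
      refine h w hw ?_
      rw [hcw]
      revert h1
      cases c u <;> cases c u' <;> simp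
    · have h1 := c.valid (h y hy hcy)
      refine h w hw ?_
      rw [hcw]
      revert h1 hcy
      cases c u <;> cases c u' <;> cases c y <;> simp
  have hsx := comp_subset_comp (H := H) (κ := κ) hx le_rfl
  have hsy := comp_subset_comp (H := H) (κ := κ) hy le_rfl
  have hsep : Separated H (comp H κ l x) (comp H κ l y) :=
    (separated_reachIn hxb hyb hxy).mono (comp_subset_reachIn hxb le_rfl)
      (comp_subset_reachIn hyb le_rfl)
  by_cases h : c x = c u'
  · have h' : c y = !(c u') := by
      revert h hcx hcy
      cases c x <;> cases c y <;> cases c u' <;> cases c u <;> simp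
    exact Layered.succ_of_complete (hsx.trans hU) (hsy.trans hU) hsep (h ▸ ih x hκx)
      (h' ▸ ih y hκy) hu' rfl fun w hw => hadj w (hw.elim (fun h => hsx h) (fun h => hsy h))
  · have h1 : c x = !(c u') := by
      revert h
      cases c x <;> cases c u' <;> simp
    have h2 : c y = c u' := by
      revert h hcx hcy
      cases c x <;> cases c y <;> cases c u' <;> cases c u <;> simp
    exact Layered.succ_of_complete (hsy.trans hU) (hsx.trans hU) hsep.symm (h2 ▸ ih y hκy)
      (h1 ▸ ih x hκx) hu' rfl fun w hw => hadj w (hw.elim (fun h => hsy h) (fun h => hsx h))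

/-- From `m` to `j - 1`, with `j` in the window of the third rule, the square root of `2 * m` drops
by at most one. -/
theorem sq_le_of_window {k m j : ℕ} (hk : (k + 3) ^ 2 ≤ 2 * m)
    (hj : (m : ℝ) - Real.sqrt (2 * (m : ℝ)) + 2 ≤ (j : ℝ)) :
    ∃ l, j = l + 1 ∧ 1 ≤ l ∧ (k + 2) ^ 2 ≤ 2 * l := by
  set s := Real.sqrt (2 * (m : ℝ)) with hs
  have hs2 : s ^ 2 = 2 * (m : ℝ) := Real.sq_sqrt (by positivity)
  have hks : (k : ℝ) + 3 ≤ s := by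
    refine Real.le_sqrt_of_sq_le ?_
    exact_mod_cast hk
  have hk0 : (0 : ℝ) ≤ k := Nat.cast_nonneg k
  have h1 : ((k : ℝ) + 2) ^ 2 + 2 ≤ 2 * j := by
    have h2 : ((k : ℝ) + 2) ^ 2 ≤ (s - 1) ^ 2 := pow_le_pow_left₀ (by linarith) (by linarith) 2
    have h3 : (s - 1) ^ 2 + 1 ≤ 2 * (j : ℝ) - 2 := by linarith [sub_sq s 1]
    nlinarith [sq_nonneg (k : ℝ), h2, h3, hs2, hks]
  have h2 : (k + 2) ^ 2 + 2 ≤ 2 * j := by exact_mod_cast h1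
  have h3 : 2 ^ 2 ≤ (k + 2) ^ 2 := Nat.pow_le_pow_left (by omega) 2
  exact ⟨j - 1, by omega, by omega, by omega⟩

theorem window_of_sub_le {k m j : ℕ} (hk : (k + 2) ^ 2 ≤ 2 * m) (hj : m ≤ j + k) :
    (m : ℝ) - Real.sqrt (2 * (m : ℝ)) + 2 ≤ (j : ℝ) := by
  have h1 : (k : ℝ) + 2 ≤ Real.sqrt (2 * (m : ℝ)) := by
    refine Real.le_sqrt_of_sq_le ?_
    exact_mod_cast hk
  have h2 : (m : ℝ) ≤ j + k := by exact_mod_cast hj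
  linarith

theorem IsGreedy.layered_of_hasUniversal (hκ : IsGreedy H κ) (c : H.Coloring Bool) {k m : ℕ}
    {v : Fin n} (hk : (k + 3) ^ 2 ≤ 2 * m)
    (ih : ∀ l, l < m → (k + 2) ^ 2 ≤ 2 * l → ∀ x, κ x = .a l →
      Layered H c k (c x) (comp H κ l x)) (h : HasUniversal H κ c m v) :
    Layered H c (k + 1) (!(c v)) (comp H κ m v) := by
  obtain ⟨u, hu, u', hu', hcu', j, huv, hκu, hj, huniv⟩ := h
  obtain ⟨l, rfl, hl, hkl⟩ := sq_le_of_window hk hj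
  have hsub : (κ u).subscript = l + 1 := by
    rcases hκu with h | h <;> rw [h] <;> rfl
  have hlm : l + 1 ≤ m := by
    rw [← hsub]
    exact ((eq_or_mem_below_of_mem_comp hu).resolve_left huv.ne).2
  have hc : (!(c v)) = c u' := by
    revert hcu'
    cases c u' <;> cases c v <;> simp
  rw [hc]
  exact hκ.layered_of_universalTo c hl hsub huniv (ih l hlm hkl)
    (comp_subset_comp hu (Nat.le_of_succ_le hlm)) hu'

/-- If `v` has no long path into the merged component of `x`, it is adjacent to all merging vertices
`z` on the opposite side in that component to whose own components nothing is universal. -/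
theorem IsGreedy.adj_of_noLongPath (hκ : IsGreedy H κ) (c : H.Coloring Bool) {l j : ℕ}
    {v x z : Fin n} (hxb : x ∈ below κ l v) (hx : x ∈ comp H κ l v)
    (hlong : NoLongPath H v (reachIn H (below κ l v) x)) (hz : z ∈ reachIn H (below κ l v) x)
    (hj : 2 ≤ j) (hκz : κ z = .a j)
    (hno : ∀ s ∈ comp H κ l v, ¬ UniversalTo H κ c s (j - 1) z) (hcz : c z ≠ c v) : H.Adj v z := by
  set K := reachIn H (below κ l v) x with hKdef
  have hsub : (κ z).subscript = (j - 1) + 1 := by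
    rw [hκz]
    simp only [Color.subscript]
    omega
  have hKv : K ⊆ comp H κ l v := fun w hw =>
    reachIn_trans hx (reachIn_mono (Set.subset_insert _ _) hw)
  have hzb : z ∈ below κ l v := reachIn_subset hxb hz
  obtain ⟨b, hb, hvb⟩ := exists_adj_of_mem_reachIn_insert hxb.1.ne hx
  obtain ⟨x', y', -, -, -, -, hxb', hyb', hx', hy', hxy'⟩ :=
    hκ.exists_merge c (m := j - 1) (by omega) hsub
  obtain ⟨a₁, ha₁, hza₁⟩ := exists_adj_of_mem_reachIn_insert hxb'.1.ne hx'
  obtain ⟨a₂, ha₂, hza₂⟩ := exists_adj_of_mem_reachIn_insert hyb'.1.ne hy'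
  refine hlong.adj c (T := below κ (j - 1) z) ?_ ?_ (reachIn_subset hxb' ha₁) hza₁
    (reachIn_subset hyb' ha₂) hza₂ ?_ ?_ hcz
  · intro w hw
    exact reachIn_trans (mem_reachIn_of_adj (Set.mem_insert _ _) (Set.mem_insert_of_mem _ hb) hvb)
      (reachIn_mono (Set.subset_insert _ _) (mem_reachIn_reachIn' hb hw))
  · have hjl : j - 1 ≤ l := by
      have := hzb.2
      omega
    exact fun w hw => reachIn_trans hz (comp_subset_reachIn hzb hjl hw)
  · exact fun h => hxy' (reachIn_trans (reachIn_trans ha₁ h) (reachIn_symm ha₂))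
  · intro s hs
    have hns := hno s (hs.elim (fun h => h ▸ mem_comp_self) fun h => hKv h)
    simp only [UniversalTo, not_or, not_forall] at hns
    obtain ⟨⟨w₁, hw₁, hc₁, hn₁⟩, ⟨w₂, hw₂, hc₂, hn₂⟩⟩ := hns
    by_cases h : c z = c s
    · exact ⟨w₂, hw₂, fun e => hc₂ (e.trans h.symm), hn₂⟩
    · exact ⟨w₁, hw₁, fun e => h (hc₁.symm.trans e), hn₁⟩

/-- If within the component `C_m[w]` no vertex is universal to a component of a vertex with color
`a_j`, where `j ≥ j₀`, then the merging vertices themselves form layered structures: each of them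
has no long path into one of the two components that it merges. -/
theorem IsGreedy.layered_of_forall_not_universalTo (hκ : IsGreedy H κ) (c : H.Coloring Bool)
    (hH : ¬ (SimpleGraph.pathGraph 9).IsIndContained H) {m j₀ : ℕ} {w : Fin n} (hj₀ : 2 ≤ j₀)
    (hno : ∀ u ∈ comp H κ m w, u < w → ∀ j, j₀ ≤ j → κ u = .a j →
      ∀ u' ∈ comp H κ m w, ¬ UniversalTo H κ c u' (j - 1) u) (i : ℕ) (v : Fin n)
    (hv : v ∈ comp H κ m w) (hκv : κ v = .a (j₀ + i)) (him : j₀ + i ≤ m) :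
    Layered H c i (c v) {z | z ∈ comp H κ (j₀ + i) v ∧ ∃ j, j₀ ≤ j ∧ κ z = .a j} := by
  induction i generalizing v with
  | zero => exact ⟨v, ⟨mem_comp_self, j₀, le_rfl, hκv⟩, rfl⟩
  | succ i ih =>
    set l := j₀ + i with hl
    have hlm : l ≤ m := by omega
    obtain ⟨x, y, hκx, hκy, hcx, hcy, hxb, hyb, hx, hy, hxy⟩ :=
      hκ.exists_merge c (m := l) (by omega) (v := v) (by rw [hκv]; rfl)
    have hvw : comp H κ l v ⊆ comp H κ m w := comp_subset_comp hv hlm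
    have hle : v ≤ w := (eq_or_mem_below_of_mem_comp hv).elim le_of_eq (fun h => h.1.le)
    have hcy' : c y = !(c v) := by
      revert hcy
      cases c y <;> cases c v <;> simp
    have hlv : comp H κ l v ⊆ comp H κ (j₀ + (i + 1)) v :=
      comp_subset_comp mem_comp_self (by omega)
    have hsx := comp_subset_reachIn (H := H) hxb le_rfl
    have hsy := comp_subset_reachIn (H := H) hyb le_rfl
    have hadj : ∀ x' ∈ below κ l v, x' ∈ comp H κ l v →
        NoLongPath H v (reachIn H (below κ l v) x') →
        v ∉ {z | z ∈ comp H κ l x' ∧ ∃ j, j₀ ≤ j ∧ κ z = .a j} ∧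
          ∀ z ∈ {z | z ∈ comp H κ l x' ∧ ∃ j, j₀ ≤ j ∧ κ z = .a j}, c z = !(c v) → H.Adj v z := by
      intro x' hxb' hx' hlong
      have hsx' := comp_subset_reachIn (H := H) hxb' le_rfl
      refine ⟨fun h => lt_irrefl v (reachIn_subset hxb' (hsx' h.1)).1, ?_⟩
      rintro z ⟨hz, j, hj, hκz⟩ hcz
      have hzb := reachIn_subset hxb' (hsx' hz)
      refine hκ.adj_of_noLongPath c hxb' hx' hlong (hsx' hz) (hj₀.trans hj) hκz ?_
        (by rw [hcz]; cases c v <;> simp)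
      intro s hs
      exact hno z (hvw (comp_subset_comp hx' le_rfl hz)) (hzb.1.trans_le hle) j hj hκz s (hvw hs)
    have hsep := separated_reachIn hxb hyb hxy
    refine ⟨_, _, ?_, ?_, hsep.mono (fun z hz => hsx hz.1) (fun z hz => hsy hz.1),
      hcx ▸ ih x (hvw hx) hκx hlm, hcy' ▸ ih y (hvw hy) hκy hlm, v,
      ⟨mem_comp_self, _, by omega, hκv⟩, rfl, ?_⟩
    · exact fun z hz => ⟨hlv (comp_subset_comp hx le_rfl hz.1), hz.2⟩
    · exact fun z hz => ⟨hlv (comp_subset_comp hy le_rfl hz.1), hz.2⟩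
    · rcases noLongPath_or_noLongPath hH hsep v with h | h
      · exact Or.inl (hadj x hxb hx h)
      · exact Or.inr (hadj y hyb hy h)

/-- A vertex of color `a_m` is on the root side of a layered structure of depth about the square
root of `2 * m` in its component. If the component has a vertex universal to the component of a
vertex with color index in the window of the third rule, on the side of `w`, then this vertex is the
root, and the depth below it is given by the induction hypothesis. By the second rule this is the
case if `c_m` occurs, and if it does not occur and there is no such vertex, then there is none on
the opposite side either. -/
theorem IsGreedy.layered_of_eq_a (hκ : IsGreedy H κ) (c : H.Coloring Bool)
    (hH : ¬ (SimpleGraph.pathGraph 9).IsIndContained H) (m k : ℕ) (w : Fin n) (hw : κ w = .a m)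
    (hk : (k + 2) ^ 2 ≤ 2 * m) : Layered H c k (c w) (comp H κ m w) := by
  induction m using Nat.strong_induction_on generalizing k w with
  | _ m ihm =>
  cases k with
  | zero => exact ⟨w, mem_comp_self, rfl⟩
  | succ k =>
    have ih : ∀ l, l < m → (k + 2) ^ 2 ≤ 2 * l → ∀ x, κ x = .a l →
        Layered H c k (c x) (comp H κ l x) := fun l hl hkl x hx => ihm l hl k x hx hkl
    rcases (hκ.of_eq_a c hw).2 with ⟨z, hz, hcz, hκz⟩ | hnot
    · have hlay := hκ.layered_of_hasUniversal c hk ih (hκ.of_eq_c c hκz).2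
      have hc : (!(c z)) = c w := by
        revert hcz
        cases c z <;> cases c w <;> simp
      rw [hc] at hlay
      exact hlay.mono (comp_subset_comp hz le_rfl)
    · by_cases hex : ∃ u ∈ comp H κ m w, u < w ∧ ∃ j, κ u = .a j ∧
          (m : ℝ) - Real.sqrt (2 * (m : ℝ)) + 2 ≤ (j : ℝ) ∧
          ∃ u' ∈ comp H κ m w, UniversalTo H κ c u' (j - 1) u
      · obtain ⟨u, hu, huw, j, hκu, hj, u', hu', huniv⟩ := hex
        have hcu' : c u' = c w := by
          by_contra h
          exact hnot ⟨u, hu, u', hu', h, j, huw, Or.inl hκu, hj, huniv⟩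
        obtain ⟨l, rfl, hl, hkl⟩ := sq_le_of_window hk hj
        have hsub : (κ u).subscript = l + 1 := by rw [hκu]; rfl
        have hlm : l + 1 ≤ m := by
          rw [← hsub]
          exact ((eq_or_mem_below_of_mem_comp hu).resolve_left huw.ne).2
        rw [← hcu']
        exact hκ.layered_of_universalTo c hl hsub huniv (ih l hlm hkl)
          (comp_subset_comp hu (Nat.le_of_succ_le hlm)) hu'
      · have hkm : 2 + (k + 1) ≤ m := by nlinarith [hk, sq_nonneg k]
        have hlay := hκ.layered_of_forall_not_universalTo c hH (m := m) (j₀ := m - (k + 1)) (w := w)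
          (by omega) (fun u hu huw j hj hκu u' hu' huniv =>
            hex ⟨u, hu, huw, j, hκu, window_of_sub_le hk (by omega), u', hu', huniv⟩)
          (k + 1) w mem_comp_self (by rw [hw]; congr 1; omega) (by omega)
        have he : m - (k + 1) + (k + 1) = m := by omega
        rw [he] at hlay
        exact hlay.mono fun z hz => hz.1

theorem IsGreedy.exists_layered (hκ : IsGreedy H κ) (c : H.Coloring Bool)
    (hH : ¬ (SimpleGraph.pathGraph 9).IsIndContained H) {k : ℕ} {v : Fin n}
    (hk : (k + 2) ^ 2 ≤ 2 * (κ v).subscript) : ∃ b U, Layered H c k b U := by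
  cases hv : κ v with
  | a m =>
    rw [hv] at hk
    exact ⟨_, _, hκ.layered_of_eq_a c hH m k v hv hk⟩
  | b m =>
    rw [hv] at hk
    obtain ⟨w, -, -, hw⟩ := hκ.of_eq_b c hv
    exact ⟨_, _, hκ.layered_of_eq_a c hH m k w hw hk⟩
  | c m =>
    rw [hv] at hk
    cases k with
    | zero => exact ⟨c v, Set.univ, v, trivial, rfl⟩
    | succ k =>
      exact ⟨_, _, hκ.layered_of_hasUniversal c hk
        (fun l _ hkl x hx => hκ.layered_of_eq_a c hH l k x hx hkl) (hκ.of_eq_c c hv).2⟩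

end Structure

/-! ### Counting colors -/

section Counting

variable {V : Type u} {n : ℕ} {G : SimpleGraph V}

theorem isGreedy_coloring (G : SimpleGraph V) (π : Fin n ≃ V) :
    IsGreedy (G.comap π) (fun w => algorithm1.coloring G π (π w)) :=
  fun v => coloring_eq_chooseColor G π v

/-- A bipartition of `G` as a coloring of the presented graph. -/
def comapColoring (c : G.Coloring Bool) (π : Fin n ≃ V) : (G.comap π).Coloring Bool :=
  SimpleGraph.Coloring.mk (c ∘ π) fun h => c.valid h

theorem colorsProperly (c : G.Coloring Bool) : algorithm1.ColorsProperly G := by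
  intro n π v w h
  have := (isGreedy_coloring G π).ne_of_adj (comapColoring c π) (v := π.symm v) (w := π.symm w)
    (by simpa using h)
  simpa using this

theorem subscript_le [Finite V] (c : G.Coloring Bool)
    (hG : ¬ (SimpleGraph.pathGraph 9).IsIndContained G) (π : Fin n ≃ V) (v : V) :
    (algorithm1.coloring G π v).subscript ≤ 2 * (onlineChromaticNumber G + 1) ^ 2 := by
  by_contra h
  have hH : ¬ (SimpleGraph.pathGraph 9).IsIndContained (G.comap π) := fun h' =>
    hG (h'.trans ⟨SimpleGraph.Embedding.comap π.toEmbedding G⟩)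
  obtain ⟨b, U, hU⟩ := (isGreedy_coloring G π).exists_layered (comapColoring c π) hH
    (k := 2 * onlineChromaticNumber G) (v := π.symm v) (by
      rw [Equiv.apply_symm_apply]
      nlinarith [h])
  exact lt_irrefl _ (lt_onlineChromaticNumber c (Layered.map (c := c) π.toEmbedding hU))

theorem ncard_subscript_le (B : ℕ) {s : Set Color}
    (h : ∀ x ∈ s, 1 ≤ x.subscript ∧ x.subscript ≤ B) : s.ncard ≤ 3 * B := by
  have hsub : s ⊆ Color.a '' Set.Icc 1 B ∪ Color.b '' Set.Icc 1 B ∪ Color.c '' Set.Icc 1 B := by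
    intro x hx
    have := h x hx
    cases x with
    | a i => exact Or.inl (Or.inl ⟨i, this, rfl⟩)
    | b i => exact Or.inl (Or.inr ⟨i, this, rfl⟩)
    | c i => exact Or.inr ⟨i, this, rfl⟩
  have hfin := Set.finite_Icc 1 B
  have hcard : (Set.Icc 1 B).ncard = B := by
    rw [← Finset.coe_Icc, Set.ncard_coe_finset, Nat.card_Icc, Nat.add_sub_cancel]
  have h1 := Set.ncard_le_ncard hsub (((hfin.image _).union (hfin.image _)).union (hfin.image _))
  have h2 := Set.ncard_union_le (Color.a '' Set.Icc 1 B ∪ Color.b '' Set.Icc 1 B)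
    (Color.c '' Set.Icc 1 B)
  have h3 := Set.ncard_union_le (Color.a '' Set.Icc 1 B) (Color.b '' Set.Icc 1 B)
  have ha := Set.ncard_image_le (f := Color.a) hfin
  have hb := Set.ncard_image_le (f := Color.b) hfin
  have hc := Set.ncard_image_le (f := Color.c) hfin
  omega

theorem numColors_le [Finite V] (c : G.Coloring Bool)
    (hG : ¬ (SimpleGraph.pathGraph 9).IsIndContained G) (π : Fin n ≃ V) :
    algorithm1.numColors G π ≤ 6 * (onlineChromaticNumber G + 1) ^ 2 := by
  have : algorithm1.numColors G π ≤ 3 * (2 * (onlineChromaticNumber G + 1) ^ 2) := by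
    refine ncard_subscript_le _ ?_
    rintro _ ⟨v, rfl⟩
    refine ⟨?_, subscript_le c hG π v⟩
    have := (isGreedy_coloring G π).one_le_subscript (π.symm v)
    rwa [Equiv.apply_symm_apply] at this
  omega

end Counting

end OnlineColoring

theorem theorem1 :
    (∀ (V : Type u) [Finite V] (G : SimpleGraph V), OnlineColoring.P9FreeBipartite V G →
      OnlineColoring.algorithm1.ColorsProperly G ∧
        ∀ (n : ℕ) (π : Fin n ≃ V),
          OnlineColoring.algorithm1.numColors G π ≤
            6 * (OnlineColoring.onlineChromaticNumber G + 1) ^ 2) ∧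
      OnlineColoring.algorithm1.IsOnlineCompetitive OnlineColoring.P9FreeBipartite.{u} := by
  have main : ∀ (V : Type u) [Finite V] (G : SimpleGraph V), OnlineColoring.P9FreeBipartite V G →
      OnlineColoring.algorithm1.ColorsProperly G ∧
        ∀ (n : ℕ) (π : Fin n ≃ V),
          OnlineColoring.algorithm1.numColors G π ≤
            6 * (OnlineColoring.onlineChromaticNumber G + 1) ^ 2 := by
    rintro V _ G ⟨⟨c⟩, hG⟩
    have c' : G.Coloring Bool := G.recolorOfEquiv finTwoEquiv c
    exact ⟨OnlineColoring.colorsProperly c', fun n π => OnlineColoring.numColors_le c' hG π⟩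
  exact ⟨main, fun x => 6 * (x + 1) ^ 2, main⟩
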